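/- **Setting.** Let $p,d\in\mathbb N$, $J,n\ge 1$, $\Xi:=\mathbb R^d\times\{1,\dots,J\}$ (with the product topology), let $\Theta\subset\mathbb R^p$ be compact and convex, $\xi_i=(x_i,y_i)\in\Xi$ for $i=1,\dots,n$, $\rho>0$, $\lambda_{\max}>0$, and let $f:\mathbb R^p\times\Xi\to\mathbb R$, $c:\Xi\times\Xi\to\mathbb R$, and probability measures $\pi_0(\cdot|\xi)$ on $\Xi$ ($\xi\in\Xi$) be given. A function is called coercive if it is continuous with compact sublevel sets. Assume: 1. (Smoothness) for each $y$, $(\theta,x)\mapsto f(\theta,x,y)$ is differentiable on $\mathbb R^p\times\mathbb R^d$ with continuous gradient. 2. (Bounded growth) $c\ge 0$ is continuous, $c(\xi,\xi)=0$ and $c(\xi,\cdot)$ is coercive for each $\xi\in\Xi$, and constants $\mu_\xi\in\mathbb R$, $\lambda_\xi\ge 0$ are given with $f(\theta,\zeta)\le\mu_\xi+\frac{\lambda_\xi}{2}c(\xi,\zeta)$ for all $\theta\in\Theta$, $\xi,\zeta\in\Xi$. 3. (Reference distribution) for all $\xi\in\Xi$ and $y'\in\{1,\dots,J\}$ the measure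 $A\mapsto\pi_0(A\times\{y'\}|\xi)$ is absolutely continuous with respect to Lebesgue measure, and there are $a>0$ and a coercive $\psi:\Xi\to\mathbb R$ such that for all $\xi\in\Xi$: $\mathbb E_{\zeta\sim\pi_0(\cdot|\xi)}[c(\xi,\zeta)^{1+a}]<\infty$, $\mathbb E_{\zeta\sim\pi_0(\cdot|\xi)}[\psi(\zeta)^{1+a}]<\infty$, and $\sup_{\theta\in\Theta}\|\nabla_\theta f(\theta,\xi)\|<\psi(\xi)$. 4. (Mixed sampling) $c((x,y),(x',y'))=\|x-x'\|^2+\kappa\,\mathbb 1_{y\ne y'}$ with $\kappa>0$, and $\pi_0(\cdot|(x,y))=\mathcal N(x,\sigma^2I_d)\otimes\operatorname{Unif}\{1,\dots,J\}$ with $\sigma^2>0$. Put $\Lambda:=\bigcap_{i=1}^n[\lambda_{\xi_i},\lambda_{\max}]$ and assume $\Lambda\subset(0,\infty)$. Let $$F(\theta,\lambda)=\lambda\rho+\frac1n\sum_{i=1}^n\phi_{\xi_i}(\theta,\lambda),\qquad \phi_\xi(\theta,\lambda)=\sup_{\zeta\in\Xi}\{f(\theta,\zeta)-\lambda c(\xi,\zeta)\}\in(-\infty,+\infty],$$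 and assume further 5. (Finiteness near $\Theta\times\Lambda$) each point of $\Theta\times\Lambda$ has a neighborhood in $\mathbb R^p\times\mathbb R$ on which $\phi_{\xi_1},\dots,\phi_{\xi_n}$ are bounded above by a finite constant. For i.i.d. samples $(\omega_\ell,z_\ell)_{\ell\ge1}$ with law $\mathcal N(0,\sigma^2I_d)\otimes\operatorname{Unif}\{1,\dots,J\}$, $\beta>0$ and $m\ge1$, let $$F^{\beta,m}(\theta,\lambda)=\lambda\rho+\frac{\beta}{n}\sum_{i=1}^n\log\Big(\frac1m\sum_{\ell=1}^m e^{\left(f(\theta,x_i+\omega_\ell,z_\ell)-\lambda\|\omega_\ell\|^2-\lambda\kappa\mathbb 1_{y_i\ne z_\ell}\right)/\beta}\Big).$$ For $w\in\mathbb R^{p+1}$ near which $F$ is finite and Lipschitz, let $\partial^cF(w)$ be the Clarke subdifferential, i.e. the convex hull of all limits $\lim_k\nabla F(w_k)$ along sequences $w_k\to w$ of points of differentiability of $F$; let $\partial^cF(w)=\emptyset$ for other $w$. For $\epsilon>0$ let $$[\partial^cF]^\epsilon(w)=\{v:\ \exists\,w',v'\text{ with } v'\in\partial^cF(w'),\ \|v-v'\|\le\epsilon,\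 \|w-w'\|\le\epsilon\},$$ with Euclidean norms on $\mathbb R^{p+1}$. **Proposition (uniform gradient consistency with sampling).** For every $\epsilon>0$ there exists $\bar\beta>0$ such that for every $\beta\in(0,\bar\beta]$, almost surely there exists $\bar m\in\mathbb N$ such that for all $m\ge\bar m$ and all $(\theta,\lambda)\in\Theta\times\Lambda$, $F^{\beta,m}$ is differentiable at $(\theta,\lambda)$ and $$\nabla F^{\beta,m}(\theta,\lambda)\in[\partial^cF]^\epsilon(\theta,\lambda).$$ -/

import Mathlib

open Set Filter Topology MeasureTheory ProbabilityTheory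

noncomputable section

namespace WDRO

/-- The parameter space `ℝᵖ × ℝ` of the pairs `(θ, λ)`, with its Euclidean norm. -/
abbrev Param (p : ℕ) : Type := WithLp 2 (EuclideanSpace ℝ (Fin p) × ℝ)

/-- The sample space `Ξ = ℝᵈ × {1, …, J}`; the labels are indexed by `Fin J`. -/
abbrev Sample (d J : ℕ) : Type := EuclideanSpace ℝ (Fin d) × Fin J

/-- The Clarke subdifferential of a function that is only defined on `dom`:
at a point near which `F` is defined and Lipschitz, it is the convex hull of the limits of
gradients of `F` along sequences converging to that point; at all other points it is empty.
The values of `F` outside `dom` play no role. -/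
def clarkeSubdifferential {E : Type*} [NormedAddCommGroup E] [InnerProductSpace ℝ E]
    [CompleteSpace E] (dom : Set E) (F : E → ℝ) (w : E) : Set E :=
  {v | (∃ (K : NNReal) (s : Set E), s ∈ 𝓝 w ∧ s ⊆ dom ∧ LipschitzOnWith K F s) ∧
    v ∈ convexHull ℝ {g | ∃ u : ℕ → E, (∀ k, DifferentiableAt ℝ F (u k)) ∧
      Tendsto u atTop (𝓝 w) ∧ Tendsto (fun k => gradient F (u k)) atTop (𝓝 g)}}

/-- The `δ`-enlargement of (the graph of) a set-valued map. -/
def enlargement {E : Type*} [NormedAddCommGroup E] (D : E → Set E) (δ : ℝ) (w : E) : Set E :=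
  {v | ∃ v' w' : E, v' ∈ D w' ∧ ‖v - v'‖ ≤ δ ∧ ‖w - w'‖ ≤ δ}

/-- A continuous real function with compact sublevel sets. -/
def Coercive {X : Type*} [TopologicalSpace X] (ψ : X → ℝ) : Prop :=
  Continuous ψ ∧ ∀ a : ℝ, IsCompact {x | ψ x ≤ a}

section Objective

variable {p d J n : ℕ}

/-- `h_ξ(θ, λ, ζ) = f(θ, ζ) - λ c(ξ, ζ)`. -/
def penalized (f : EuclideanSpace ℝ (Fin p) → Sample d J → ℝ)
    (c : Sample d J → Sample d J → ℝ) (ξ : Sample d J) (w : Param p) (ζ : Sample d J) : ℝ :=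
  f w.fst ζ - w.snd * c ξ ζ

/-- `φ_ξ(θ, λ) = sup_ζ (f(θ, ζ) - λ c(ξ, ζ))`; meaningful where the supremum is finite. -/
def dualFun (f : EuclideanSpace ℝ (Fin p) → Sample d J → ℝ)
    (c : Sample d J → Sample d J → ℝ) (ξ : Sample d J) (w : Param p) : ℝ :=
  ⨆ ζ : Sample d J, penalized f c ξ w ζ

/-- The set of the `(θ, λ)` at which all the suprema entering the objective are finite. -/
def finiteDomain (f : EuclideanSpace ℝ (Fin p) → Sample d J → ℝ)
    (c : Sample d J → Sample d J → ℝ) (ξ : Fin n → Sample d J) : Set (Param p) :=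
  {w | ∀ i, BddAbove (range (penalized f c (ξ i) w))}

/-- The dual objective `F(θ, λ) = λ ρ + (1/n) ∑ᵢ φ_{ξᵢ}(θ, λ)`. -/
def objective (f : EuclideanSpace ℝ (Fin p) → Sample d J → ℝ)
    (c : Sample d J → Sample d J → ℝ) (ξ : Fin n → Sample d J) (ρ : ℝ) (w : Param p) : ℝ :=
  w.snd * ρ + (1 / (n : ℝ)) * ∑ i, dualFun f c (ξ i) w

/-- The sampled objective `F^{β,m}`; `s ℓ = (ω_ℓ, z_ℓ)` are the samples, for `ℓ < m`. -/
def sampledObjective (f : EuclideanSpace ℝ (Fin p) → Sample d J → ℝ)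
    (ξ : Fin n → Sample d J) (ρ κ β : ℝ) (m : ℕ) (s : ℕ → Sample d J) (w : Param p) : ℝ :=
  w.snd * ρ + (β / (n : ℝ)) * ∑ i, Real.log ((1 / (m : ℝ)) * ∑ ℓ ∈ Finset.range m,
    Real.exp ((f w.fst ((ξ i).1 + (s ℓ).1, (s ℓ).2) - w.snd * ‖(s ℓ).1‖ ^ 2
      - w.snd * κ * (if (ξ i).2 ≠ (s ℓ).2 then 1 else 0)) / β))

/-- `Θ × Λ` with `Λ = ⋂ᵢ [λ_{ξᵢ}, λ_max]`. -/
def paramSet (Θ : Set (EuclideanSpace ℝ (Fin p))) (lam : Sample d J → ℝ) (lamMax : ℝ)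
    (ξ : Fin n → Sample d J) : Set (Param p) :=
  {w | w.fst ∈ Θ ∧ ∀ i, w.snd ∈ Icc (lam (ξ i)) lamMax}

end Objective

/-- The law `𝒩(x, σ² I_d) ⊗ Unif {1, …, J}`. -/
def gaussianUnif {d : ℕ} (J : ℕ) (x : EuclideanSpace ℝ (Fin d)) (σ : ℝ) : Measure (Sample d J) :=
  (multivariateGaussian x (σ ^ 2 • (1 : Matrix (Fin d) (Fin d) ℝ))).prod
    (uniformOn (univ : Set (Fin J)))

/-- Smoothness, bounded growth and reference distribution assumptions on the loss `f`, the cost `c`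
and the conditional reference distributions `π₀(· | ξ)`, with growth constants `μ_ξ`, `λ_ξ`. -/
structure StandingAssumption {p d J : ℕ} (Θ : Set (EuclideanSpace ℝ (Fin p)))
    (f : EuclideanSpace ℝ (Fin p) → Sample d J → ℝ) (c : Sample d J → Sample d J → ℝ)
    (π₀ : Sample d J → Measure (Sample d J)) (mu lam : Sample d J → ℝ) : Prop where
  differentiable : ∀ y : Fin J, Differentiable ℝ
    (fun q : EuclideanSpace ℝ (Fin p) × EuclideanSpace ℝ (Fin d) => f q.1 (q.2, y))
  continuous_fderiv : ∀ y : Fin J, Continuous (fderiv ℝ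
    (fun q : EuclideanSpace ℝ (Fin p) × EuclideanSpace ℝ (Fin d) => f q.1 (q.2, y)))
  cost_nonneg : ∀ ξ ζ, 0 ≤ c ξ ζ
  cost_continuous : Continuous (fun q : Sample d J × Sample d J => c q.1 q.2)
  cost_self : ∀ ξ, c ξ ξ = 0
  cost_coercive : ∀ ξ, Coercive (c ξ)
  lam_nonneg : ∀ ξ, 0 ≤ lam ξ
  growth : ∀ ξ, ∀ θ ∈ Θ, ∀ ζ, f θ ζ ≤ mu ξ + lam ξ / 2 * c ξ ζ
  ref_prob : ∀ ξ, IsProbabilityMeasure (π₀ ξ)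
  ref_absolutelyContinuous : ∀ ξ, ∀ y' : Fin J,
    ((π₀ ξ).restrict {ζ | ζ.2 = y'}).map Prod.fst ≪ volume
  ref_moments : ∃ (a : ℝ) (ψ : Sample d J → ℝ), 0 < a ∧ Coercive ψ ∧
    (∀ ξ, Integrable (fun ζ => c ξ ζ ^ (1 + a)) (π₀ ξ)) ∧
    (∀ ξ, ∀ θ ∈ Θ, ‖gradient (fun t => f t ξ) θ‖ < ψ ξ) ∧
    (∀ ξ, Integrable (fun ζ => ψ ζ ^ (1 + a)) (π₀ ξ))

/-- Mixed sampling: quadratic cost with label switching price `κ`, and Gaussian-uniform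
reference distribution with variance `σ²`. -/
structure MixedSampling {d J : ℕ} (c : Sample d J → Sample d J → ℝ)
    (π₀ : Sample d J → Measure (Sample d J)) (κ σ : ℝ) : Prop where
  kappa_pos : 0 < κ
  sigma_pos : 0 < σ
  cost_eq : ∀ ξ ζ, c ξ ζ = ‖ξ.1 - ζ.1‖ ^ 2 + κ * (if ξ.2 ≠ ζ.2 then 1 else 0)
  ref_eq : ∀ ξ, π₀ ξ = gaussianUnif J ξ.1 σ

end WDRO

end

/-! The key is a nonlocal minorant. Put `K = Θ × Λ` and let `v` be the gradient of the sampled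
objective at `w ∈ K`. For small fixed `r, η, δ`, all small `β` and all large `m`, it is shown that
`F w + ⟪v, u⟫ - η ‖u‖ - 3δ ≤ F (w + u)` whenever `w ∈ K` and `‖u‖ ≤ r`.

This inequality is a softmax average. Near-maximizers `ζ` of `h w = penalized f c (ξ i) w` stay in
one compact set (`exists_compact_near_maximizers`), so a first-order expansion of `h · ζ`, uniform
in `w` and `ζ`, bounds the supremum at `w + u` from below. The other samples carry a relative weight
of order `exp (-δ / β)`, against an integrable envelope of the slopes. By compactness, finitely many
open sets of positive mass contain near-maximizers for every `w ∈ K`; hence finitely many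
applications of the strong law give a null set and a threshold for `m` that do not depend on `w`
(`exists_temperature_softmaxSlope_minorant`).

An approximate minorant is then turned into a Clarke subgradient
(`mem_enlargement_of_approx_minorant`). Minimizing `F (w + u) - ⟪v, u⟫ + 2η ‖u‖` over the ball gives
an interior point where `v` is a first-order minorant up to slope `2η`. There, Rademacher's theorem,
Fubini and Hahn–Banach place `v` within `4η` of the Clarke subdifferential. Convergence of values or
gradients of the sampled objective is never needed. -/

namespace WDRO

open scoped RealInnerProductSpace

/-! ### Clarke subgradients from approximate linear minorants. -/

section Clarke

variable {E : Type*} [NormedAddCommGroup E] [InnerProductSpace ℝ E]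

/-- Along almost every line, a Lipschitz function is the integral of its derivative; hence
the increment of `F` along a segment is nearly dominated by a directional derivative of `F` at
some point of differentiability near this segment. -/
theorem exists_differentiableAt_slope_le [FiniteDimensional ℝ E] {F : E → ℝ} {K : NNReal}
    (hF : LipschitzWith K F) (w d : E) {t τ : ℝ} (ht : 0 < t) (hτ : 0 < τ) :
    ∃ y, ‖y - w‖ ≤ τ + t * ‖d‖ ∧ DifferentiableAt ℝ F y ∧
      F (w + t • d) - F w - τ ≤ t * fderiv ℝ F y d := by
  borelize E
  have hae : ∀ᵐ y ∂(Measure.addHaar : Measure E), y ∈ {x | DifferentiableAt ℝ F x} :=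
    hF.ae_differentiableAt
  -- Fubini: for almost every `y`, `F` is differentiable at almost every point of the line `y + ℝ
  -- d`. Such `y` are dense, so one lies near `w`.
  have hae' := (ae_ae_add_linearMap_mem_iff (LinearMap.toSpanSingleton ℝ E d)
    (volume : Measure ℝ) (Measure.addHaar : Measure E)
    (measurableSet_of_differentiableAt ℝ F)).2 hae
  -- Moving the base point from `w` to `y` costs at most `τ / 4` at each end of the segment, which
  -- keeps `hinc` strict.
  set τ' : ℝ := min τ (τ / (4 * (K + 1))) with hτ'def
  have hK : (0 : ℝ) ≤ K := K.2
  have hτ' : 0 < τ' := by positivity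
  have hdense := Measure.dense_of_ae hae'
  obtain ⟨y, hy, hyw⟩ := hdense.exists_mem_open (Metric.isOpen_ball (x := w) (ε := τ'))
    ⟨w, Metric.mem_ball_self hτ'⟩
  have hyw' : ‖y - w‖ < τ' := by simpa [dist_eq_norm] using hyw
  set g : ℝ → ℝ := fun s => F (y + s • d) with hg
  have hgL : LipschitzWith (K * ‖d‖₊) g := by
    refine hF.comp (LipschitzWith.of_dist_le_mul fun a b => ?_)
    rw [dist_eq_norm, add_sub_add_left_eq_sub, ← sub_smul, norm_smul, coe_nnnorm,
      dist_eq_norm, mul_comm]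
  have hint := ((hgL.lipschitzOnWith (s := uIcc 0 t)).absolutelyContinuousOnInterval)
  have hFTC := hint.integral_deriv_eq_sub
  have hII := hint.intervalIntegrable_deriv
  have hw1 : |F y - F w| ≤ K * ‖y - w‖ := by
    simpa [Real.dist_eq, dist_eq_norm] using hF.dist_le_mul y w
  have hw2 : |F (y + t • d) - F (w + t • d)| ≤ K * ‖y - w‖ := by
    simpa [Real.dist_eq, dist_eq_norm] using hF.dist_le_mul (y + t • d) (w + t • d)
  have hKτ : K * ‖y - w‖ ≤ τ / 4 := by
    have h1 : ‖y - w‖ ≤ τ / (4 * (K + 1)) := hyw'.le.trans (min_le_right _ _)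
    calc (K : ℝ) * ‖y - w‖ ≤ (K + 1) * (τ / (4 * (K + 1))) := by
          gcongr; linarith
      _ = τ / 4 := by field_simp
  have hinc : F (w + t • d) - F w - τ < g t - g 0 := by
    simp only [hg, zero_smul, add_zero]
    have := abs_le.1 hw1; have := abs_le.1 hw2
    linarith
  have hex : ∃ s ∈ Ioc 0 t, DifferentiableAt ℝ F (y + s • d) ∧
      (F (w + t • d) - F w - τ) / t ≤ deriv g s := by
    by_contra! hcon
    have hle : ∫ s in (0 : ℝ)..t, deriv g s ≤ ∫ _ in (0 : ℝ)..t,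
        (F (w + t • d) - F w - τ) / t := by
      refine intervalIntegral.integral_mono_ae_restrict ht.le hII (by simp) ?_
      rw [EventuallyLE, ae_restrict_iff' measurableSet_Icc]
      have h0 : ∀ᵐ s : ℝ, s ≠ 0 := by simp [ae_iff]
      filter_upwards [hy, h0] with s hs hs0 hst
      exact (hcon s ⟨lt_of_le_of_ne hst.1 (Ne.symm hs0), hst.2⟩ (by simpa using hs)).le
    rw [hFTC] at hle
    simp only [intervalIntegral.integral_const, sub_zero, smul_eq_mul] at hle
    rw [mul_div_cancel₀ _ ht.ne'] at hle
    linarith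
  obtain ⟨s, hs, hdiff, hle⟩ := hex
  refine ⟨y + s • d, ?_, hdiff, ?_⟩
  · calc ‖y + s • d - w‖ = ‖(y - w) + s • d‖ := by congr 1; abel
      _ ≤ ‖y - w‖ + ‖s • d‖ := norm_add_le _ _
      _ ≤ τ + t * ‖d‖ := by
        rw [norm_smul, Real.norm_of_nonneg hs.1.le]
        gcongr
        · exact hyw'.le.trans (min_le_left _ _)
        · exact hs.2
  · have hder : deriv g s = fderiv ℝ F (y + s • d) d := by
      have h1 : HasDerivAt (fun s : ℝ => y + s • d) d s := by
        simpa using ((hasDerivAt_id s).smul_const d).const_add y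
      exact (hdiff.hasFDerivAt.comp_hasDerivAt s h1).deriv
    rw [hder, div_le_iff₀ ht] at hle
    linarith

/-- A linear minorant up to first order at `w` is dominated, in each direction, by a limit of
gradients at points converging to `w`. -/
theorem exists_limit_gradient_ge [FiniteDimensional ℝ E] {F : E → ℝ} {K : NNReal} {w v : E}
    {r η : ℝ} (hr : 0 < r) (hF : LipschitzOnWith K F (Metric.ball w r))
    (hv : ∀ᶠ u in 𝓝 (0 : E), F w + ⟪v, u⟫ - η * ‖u‖ ≤ F (w + u)) (d : E) :
    ∃ g, (∃ u : ℕ → E, (∀ k, DifferentiableAt ℝ F (u k)) ∧ Tendsto u atTop (𝓝 w) ∧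
      Tendsto (fun k => gradient F (u k)) atTop (𝓝 g)) ∧ ⟪v, d⟫ - η * ‖d‖ ≤ ⟪g, d⟫ := by
  -- Rademacher's theorem is used for a global Lipschitz extension, which has the same gradients
  -- inside the ball.
  obtain ⟨F', hF', heq⟩ := hF.extend_real
  have hloc : ∀ y ∈ Metric.ball w r, F =ᶠ[𝓝 y] F' := fun y hy =>
    (heq.eventuallyEq_of_mem (Metric.isOpen_ball.mem_nhds hy))
  have hstep : ∀ k : ℕ, ∃ y, ‖y - w‖ ≤ 1 / ((k : ℝ) + 1) ∧ DifferentiableAt ℝ F y ∧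
      ‖gradient F y‖ ≤ K ∧ ⟪v, d⟫ - η * ‖d‖ - 1 / ((k : ℝ) + 1) ≤ ⟪gradient F y, d⟫ := by
    intro k
    set q : ℝ := min (1 / ((k : ℝ) + 1)) (r / 2) with hq
    have hq0 : 0 < q := by positivity
    have hcont : Tendsto (fun t : ℝ => t • d) (𝓝[>] 0) (𝓝 0) := by
      have : Tendsto (fun t : ℝ => t • d) (𝓝 0) (𝓝 ((0 : ℝ) • d)) :=
        (continuous_id.smul continuous_const).tendsto 0
      rw [zero_smul] at this
      exact this.mono_left nhdsWithin_le_nhds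
    have hball : ∀ᶠ u in 𝓝 (0 : E), ‖u‖ < q / 2 := by
      filter_upwards [Metric.ball_mem_nhds (0 : E) (half_pos hq0)] with u hu using by simpa using hu
    have hsmall : ∀ᶠ t : ℝ in 𝓝[>] 0, t ≤ 1 / 2 :=
      nhdsWithin_le_nhds (eventually_le_nhds (by norm_num))
    obtain ⟨t, ⟨⟨ht1, ht2⟩, ht3⟩, ht0 : 0 < t⟩ :=
      ((((hcont.eventually hv).and (hcont.eventually hball)).and hsmall).and
        self_mem_nhdsWithin).exists
    rw [norm_smul, Real.norm_of_nonneg ht0.le] at ht2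
    -- The tolerance `t * q` leaves an error of only `q` after division by `t`.
    obtain ⟨y, hy1, hy2, hy3⟩ := exists_differentiableAt_slope_le hF' w d ht0
      (mul_pos ht0 hq0)
    have hyq : ‖y - w‖ < q := by nlinarith
    have hyball : y ∈ Metric.ball w r := by
      rw [Metric.mem_ball, dist_eq_norm]
      have : q ≤ r / 2 := min_le_right _ _
      linarith
    have hgrad : gradient F y = gradient F' y := (hloc y hyball).gradient_eq
    refine ⟨y, hyq.le.trans (min_le_left _ _), (hloc y hyball).differentiableAt_iff.2 hy2, ?_, ?_⟩
    · rw [hgrad, gradient, LinearIsometryEquiv.norm_map]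
      exact norm_fderiv_le_of_lipschitz ℝ hF'
    · rw [hgrad, inner_gradient_left]
      have hw : F w = F' w := heq (Metric.mem_ball_self hr)
      have hwt : F (w + t • d) = F' (w + t • d) := by
        apply heq
        rw [Metric.mem_ball, dist_eq_norm, add_sub_cancel_left, norm_smul,
          Real.norm_of_nonneg ht0.le]
        have : q ≤ r / 2 := min_le_right _ _
        linarith
      rw [hw, hwt, inner_smul_right, norm_smul, Real.norm_of_nonneg ht0.le] at ht1
      have h2 : t * (⟪v, d⟫ - η * ‖d‖ - q) ≤ t * fderiv ℝ F' y d := by linarith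
      have h3 := le_of_mul_le_mul_left h2 ht0
      have : q ≤ 1 / ((k : ℝ) + 1) := min_le_left _ _
      linarith
  choose y hy1 hy2 hy3 hy4 using hstep
  have hlim0 := tendsto_one_div_add_atTop_nhds_zero_nat (𝕜 := ℝ)
  obtain ⟨g, -, φ, hφ, hg⟩ := (isCompact_closedBall (0 : E) K).tendsto_subseq
    (x := fun k => gradient F (y k)) (fun k => by simpa using hy3 k)
  refine ⟨g, ⟨y ∘ φ, fun k => hy2 _, ?_, hg⟩, ?_⟩
  · have : Tendsto y atTop (𝓝 w) := tendsto_iff_norm_sub_tendsto_zero.2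
      (squeeze_zero (fun _ => norm_nonneg _) hy1 hlim0)
    exact this.comp hφ.tendsto_atTop
  · have h1 : Tendsto (fun k => ⟪gradient F (y (φ k)), d⟫) atTop (𝓝 ⟪g, d⟫) :=
      hg.inner tendsto_const_nhds
    have h2 : Tendsto (fun k : ℕ => ⟪v, d⟫ - η * ‖d‖ - 1 / (((φ k : ℕ) : ℝ) + 1)) atTop
        (𝓝 (⟪v, d⟫ - η * ‖d‖ - 0)) :=
      tendsto_const_nhds.sub (hlim0.comp hφ.tendsto_atTop)
    rw [sub_zero] at h2
    exact le_of_tendsto_of_tendsto' h2 h1 fun k => hy4 (φ k)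

/-- A linear minorant up to first order is close to a Clarke subgradient. -/
theorem exists_mem_clarkeSubdifferential_of_minorant [FiniteDimensional ℝ E] {dom : Set E}
    {F : E → ℝ} {K : NNReal} {w v : E} {r η : ℝ} (hr : 0 < r) (hη : 0 < η)
    (hdom : Metric.ball w r ⊆ dom) (hF : LipschitzOnWith K F (Metric.ball w r))
    (hv : ∀ᶠ u in 𝓝 (0 : E), F w + ⟪v, u⟫ - η * ‖u‖ ≤ F (w + u)) :
    ∃ v' ∈ clarkeSubdifferential dom F w, ‖v - v'‖ ≤ 2 * η := by
  set A : Set E := {g | ∃ u : ℕ → E, (∀ k, DifferentiableAt ℝ F (u k)) ∧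
      Tendsto u atTop (𝓝 w) ∧ Tendsto (fun k => gradient F (u k)) atTop (𝓝 g)} with hA
  have hlip : ∃ (K : NNReal) (s : Set E), s ∈ 𝓝 w ∧ s ⊆ dom ∧ LipschitzOnWith K F s :=
    ⟨K, _, Metric.ball_mem_nhds w hr, hdom, hF⟩
  by_contra! hcon
  have hdisj : Disjoint (Metric.ball v (2 * η)) (convexHull ℝ A) := by
    rw [Set.disjoint_left]
    intro a ha ha'
    have := hcon a ⟨hlip, ha'⟩
    rw [Metric.mem_ball, dist_comm, dist_eq_norm] at ha
    linarith
  -- The ball is open, so the convex hull need not be closed.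
  obtain ⟨f, u, hf1, hf2⟩ := geometric_hahn_banach_open (convex_ball v (2 * η))
    Metric.isOpen_ball (convex_convexHull ℝ A) hdisj
  set e := (InnerProductSpace.toDual ℝ E).symm f with he
  have hfe : ∀ x, f x = ⟪e, x⟫ := fun x => by
    rw [he, InnerProductSpace.toDual_symm_apply]
  -- Direction `-e` yields `⟪g, e⟫ ≤ ⟪v, e⟫ + η ‖e‖`, while separation at `v + (η / ‖e‖) • e` gives
  -- the strict opposite.
  obtain ⟨g, hgA, hg⟩ := exists_limit_gradient_ge hr hF hv (-e)
  have hug := hf2 g (subset_convexHull ℝ A hgA)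
  have hve := hf1 v (Metric.mem_ball_self (by linarith))
  rw [hfe, real_inner_comm] at hug
  rw [hfe, real_inner_comm] at hve
  rw [inner_neg_right, inner_neg_right, norm_neg] at hg
  have he0 : 0 < ‖e‖ := by
    rw [norm_pos_iff]
    intro h
    simp only [h, inner_zero_right] at hug hve
    linarith
  have hv2 := hf1 (v + (η / ‖e‖) • e) (by
    rw [Metric.mem_ball, dist_eq_norm, add_sub_cancel_left, norm_smul, norm_div, norm_norm,
      div_mul_cancel₀ _ he0.ne', Real.norm_of_nonneg hη.le]
    linarith)
  rw [hfe, inner_add_right, inner_smul_right, real_inner_self_eq_norm_sq, real_inner_comm] at hv2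
  have : η / ‖e‖ * ‖e‖ ^ 2 = η * ‖e‖ := by field_simp
  linarith

/-- A linear minorant of `F` at `w`, valid up to a small error on a ball, is close to a Clarke
subgradient of `F` at a point of this ball. -/
theorem mem_enlargement_of_approx_minorant [FiniteDimensional ℝ E] {dom : Set E}
    {F : E → ℝ} {w v : E} {r η δ ε : ℝ} (hr : 0 < r) (hη : 0 < η) (hδ : δ < η * r)
    (hrε : r ≤ ε) (hηε : 4 * η ≤ ε)
    (hF : ∀ w', ‖w' - w‖ ≤ r → ∃ K : NNReal, ∃ q > 0, Metric.ball w' q ⊆ dom ∧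
      LipschitzOnWith K F (Metric.ball w' q))
    (hv : ∀ u, ‖u‖ ≤ r → F w + ⟪v, u⟫ - η * ‖u‖ - δ ≤ F (w + u)) :
    v ∈ enlargement (clarkeSubdifferential dom F) ε w := by
  set G : E → ℝ := fun u => F (w + u) - ⟪v, u⟫ + 2 * η * ‖u‖ with hG
  have hcont : ContinuousOn G (Metric.closedBall 0 r) := by
    intro u hu
    obtain ⟨K, q, hq, -, hL⟩ := hF (w + u) (by simpa using hu)
    have h1 : ContinuousAt F (w + u) :=
      (hL.continuousOn).continuousAt (Metric.ball_mem_nhds _ hq)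
    have h2 : ContinuousAt (fun u => F (w + u)) u :=
      ContinuousAt.comp (f := fun u => w + u) h1 (by fun_prop)
    have h3 : ContinuousAt G u := by
      simp only [hG]
      exact (h2.sub (by fun_prop)).add (by fun_prop)
    exact h3.continuousWithinAt
  obtain ⟨z, hz, hmin⟩ := (isCompact_closedBall (0 : E) r).exists_isMinOn
    ⟨0, Metric.mem_closedBall_self hr.le⟩ hcont
  have hzr : ‖z‖ ≤ r := by simpa using hz
  have h0 : G z ≤ G 0 := hmin (Metric.mem_closedBall_self hr.le)
  -- On the sphere `G ≥ F w + η r - δ > G 0`, so the minimizer is interior.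
  have hzlt : ‖z‖ < r := by
    refine lt_of_le_of_ne hzr fun h => ?_
    have := hv z hzr
    simp only [hG, add_zero, inner_zero_right, sub_zero, norm_zero, mul_zero] at h0
    rw [h] at this h0
    linarith
  obtain ⟨K, q, hq, hqd, hL⟩ := hF (w + z) (by simpa using hzr)
  obtain ⟨v', hv', hvv'⟩ := exists_mem_clarkeSubdifferential_of_minorant (η := 2 * η) (v := v) hq
    (by linarith) hqd hL (by
      have : ∀ᶠ u in 𝓝 (0 : E), ‖u‖ < r - ‖z‖ := by
        filter_upwards [Metric.ball_mem_nhds (0 : E) (sub_pos.2 hzlt)] with u hu using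
          by simpa using hu
      filter_upwards [this] with u hu
      have h1 : ‖z + u‖ ≤ ‖z‖ + ‖u‖ := norm_add_le _ _
      have h2 : G z ≤ G (z + u) := hmin (by simpa using by linarith)
      simp only [hG, inner_add_right, ← add_assoc] at h2
      have h3 := mul_le_mul_of_nonneg_left h1 (show 0 ≤ 2 * η by linarith)
      linarith)
  refine ⟨v', w + z, hv', by linarith, ?_⟩
  rw [sub_add_cancel_left, norm_neg]
  linarith

end Clarke

/-! ### Full support of the sampling law, strong laws, and the softmax estimate. -/

section Sampling

open Measure

instance isOpenPosMeasure_gaussianReal_zero_one : IsOpenPosMeasure (gaussianReal 0 1) :=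
  (gaussianReal_absolutelyContinuous' 0 one_ne_zero).isOpenPosMeasure

instance isOpenPosMeasure_stdGaussian {E : Type*} [NormedAddCommGroup E] [InnerProductSpace ℝ E]
    [FiniteDimensional ℝ E] [MeasurableSpace E] [BorelSpace E] :
    IsOpenPosMeasure (stdGaussian E) := by
  refine Continuous.isOpenPosMeasure_map (by fun_prop) fun x => ?_
  refine ⟨fun i => (stdOrthonormalBasis ℝ E).repr x i, ?_⟩
  exact (stdOrthonormalBasis ℝ E).sum_repr x

theorem isOpenPosMeasure_multivariateGaussian {ι : Type*} [Fintype ι] [DecidableEq ι]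
    (x : EuclideanSpace ℝ ι) {S : Matrix ι ι ℝ} (hS : S.PosDef) :
    IsOpenPosMeasure (multivariateGaussian x S) := by
  open scoped MatrixOrder in
  refine Continuous.isOpenPosMeasure_map (by fun_prop) fun y => ?_
  -- `√S * S⁻¹` is a right inverse of `√S`.
  refine ⟨Matrix.toEuclideanCLM (𝕜 := ℝ) (CFC.sqrt S)
    (Matrix.toEuclideanCLM (𝕜 := ℝ) S⁻¹ (y - x)), ?_⟩
  have h1 : CFC.sqrt S * CFC.sqrt S = S := CFC.sqrt_mul_sqrt_self S hS.posSemidef.nonneg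
  have h2 : S * S⁻¹ = 1 := Matrix.mul_nonsing_inv S hS.det_pos.ne'.isUnit
  rw [← mul_apply_eq_comp, ← mul_apply_eq_comp, ← map_mul, ← map_mul, h1, h2,
    map_one]
  simp

theorem isOpenPosMeasure_gaussianUnif {d J : ℕ} (hJ : 1 ≤ J) (x : EuclideanSpace ℝ (Fin d))
    {σ : ℝ} (hσ : 0 < σ) : IsOpenPosMeasure (gaussianUnif J x σ) := by
  have : NeZero J := ⟨by omega⟩
  have h1 : IsOpenPosMeasure
      (multivariateGaussian x (σ ^ 2 • (1 : Matrix (Fin d) (Fin d) ℝ))) :=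
    isOpenPosMeasure_multivariateGaussian x (Matrix.PosDef.one.smul (by positivity))
  have h2 : IsProbabilityMeasure (uniformOn (univ : Set (Fin J))) :=
    isProbabilityMeasure_uniformOn finite_univ univ_nonempty
  have h3 : IsOpenPosMeasure (uniformOn (univ : Set (Fin J))) :=
    ⟨fun U _ hU => by
      rw [uniformOn_univ]
      simpa [ENNReal.div_eq_zero_iff, Measure.count_eq_zero_iff] using hU.ne_empty⟩
  unfold gaussianUnif
  infer_instance

/-- Translation of the spatial part of `ζ` by that of `ξ`. -/
def translate {d J : ℕ} (ξ ζ : Sample d J) : Sample d J := (ξ.1 + ζ.1, ζ.2)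

theorem measurable_translate {d J : ℕ} (ξ : Sample d J) : Measurable (translate ξ) := by
  unfold translate
  fun_prop

/-- Lets one centred sample sequence serve all the data points `ξ i`. -/
theorem map_translate_gaussianUnif {d J : ℕ} (ξ : Sample d J) (σ : ℝ) :
    (gaussianUnif J (0 : EuclideanSpace ℝ (Fin d)) σ).map (translate ξ) =
      gaussianUnif J ξ.1 σ := by
  have h : translate ξ = Prod.map (fun v => ξ.1 + v) (id : Fin J → Fin J) := rfl
  have h2 : SFinite (uniformOn (univ : Set (Fin J))) := by unfold uniformOn; infer_instance
  rw [gaussianUnif, gaussianUnif, h, ← Measure.map_prod_map _ _ (by fun_prop) measurable_id,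
    Measure.map_id]
  congr 1
  rw [multivariateGaussian, multivariateGaussian, Measure.map_map (by fun_prop) (by fun_prop)]
  congr 1
  ext v
  simp

variable {Ω X : Type*} [MeasurableSpace Ω] [MeasurableSpace X] {P : Measure Ω} {ν : Measure X}
  {s : ℕ → Ω → X}

theorem ae_tendsto_average_comp (hlaw : ∀ ℓ, HasLaw (s ℓ) ν P) (hind : iIndepFun s P) {g : X → ℝ}
    (hg : Measurable g) (hgi : Integrable g ν) :
    ∀ᵐ o ∂P, Tendsto (fun m : ℕ => (∑ ℓ ∈ Finset.range m, g (s ℓ o)) / m) atTop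
      (𝓝 (∫ x, g x ∂ν)) := by
  have hident : ∀ i, IdentDistrib (fun o => g (s i o)) (fun o => g (s 0 o)) P P := fun i =>
    (IdentDistrib.mk (hlaw i).aemeasurable (hlaw 0).aemeasurable
      ((hlaw i).map_eq.trans (hlaw 0).map_eq.symm)).comp hg
  have hint : Integrable (fun o => g (s 0 o)) P := by
    rw [← (hlaw 0).map_eq] at hgi
    exact hgi.comp_aemeasurable (hlaw 0).aemeasurable
  have hpair : Pairwise (Function.onFun (fun f g => IndepFun f g P)
      (fun i o => g (s i o))) := fun i j hij => (hind.indepFun hij).comp hg hg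
  have h := strong_law_ae_real (fun i o => g (s i o)) hint hpair hident
  have hE : ∫ o, g (s 0 o) ∂P = ∫ x, g x ∂ν := by
    rw [← (hlaw 0).map_eq, integral_map (hlaw 0).aemeasurable hg.aestronglyMeasurable]
  rwa [hE] at h

theorem ae_eventually_sum_comp_le (hlaw : ∀ ℓ, HasLaw (s ℓ) ν P) (hind : iIndepFun s P)
    {g : X → ℝ} (hg : Measurable g) (hgi : Integrable g ν) {C : ℝ} (hC : ∫ x, g x ∂ν < C) :
    ∀ᵐ o ∂P, ∀ᶠ m : ℕ in atTop, ∑ ℓ ∈ Finset.range m, g (s ℓ o) ≤ C * m := by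
  filter_upwards [ae_tendsto_average_comp hlaw hind hg hgi] with o ho
  filter_upwards [ho.eventually (eventually_le_nhds hC), eventually_gt_atTop 0] with m hm hm0
  rwa [div_le_iff₀ (by exact_mod_cast hm0)] at hm

theorem ae_eventually_le_sum_indicator [IsProbabilityMeasure P]
    (hlaw : ∀ ℓ, HasLaw (s ℓ) ν P) (hind : iIndepFun s P)
    {O : Set X} (hO : MeasurableSet O) {q : ℝ} (hq : q < ν.real O) :
    ∀ᵐ o ∂P, ∀ᶠ m : ℕ in atTop,
      q * m ≤ ∑ ℓ ∈ Finset.range m, O.indicator (fun _ => (1 : ℝ)) (s ℓ o) := by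
  have : IsProbabilityMeasure ν := (hlaw 0).isProbabilityMeasure_iff.1 inferInstance
  have hint : ∫ x, O.indicator (fun _ => (1 : ℝ)) x ∂ν = ν.real O := by
    simp [integral_indicator hO]
  filter_upwards [ae_tendsto_average_comp hlaw hind (measurable_const.indicator hO)
    ((integrable_const (1 : ℝ)).indicator hO)] with o ho
  rw [hint] at ho
  filter_upwards [ho.eventually (eventually_ge_nhds hq), eventually_gt_atTop 0] with m hm hm0
  rwa [le_div_iff₀ (by exact_mod_cast hm0)] at hm

/-- A softmax average at low temperature is nearly bounded by `b` when all the entries of nearly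
maximal weight are, provided that a fixed proportion of the entries is nearly maximal. -/
theorem softmax_average_le {m : ℕ} {h a G : ℕ → ℝ} {β φ δ q C b : ℝ} (hm : 0 < m) (hβ : 0 < β)
    (hδ : 0 < δ) (hq : 0 < q) (hG : ∀ ℓ, 0 ≤ G ℓ)
    (hnear : ∃ g : ℕ → ℝ, (∀ ℓ, g ℓ ≤ 1) ∧ (∀ ℓ, h ℓ < φ - δ → g ℓ ≤ 0) ∧
      q * m ≤ ∑ ℓ ∈ Finset.range m, g ℓ)
    (hGsum : ∑ ℓ ∈ Finset.range m, G ℓ ≤ C * m) (hβC : C * Real.exp (-δ / β) ≤ δ * q)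
    (hgood : ∀ ℓ, φ - 2 * δ ≤ h ℓ → a ℓ ≤ b) (hbad : ∀ ℓ, a ℓ ≤ b + G ℓ) :
    (∑ ℓ ∈ Finset.range m, Real.exp (h ℓ / β) * a ℓ) /
      ∑ ℓ ∈ Finset.range m, Real.exp (h ℓ / β) ≤ b + δ := by
  obtain ⟨g, hg1, hg0, hgs⟩ := hnear
  have hm' : (0 : ℝ) < m := by exact_mod_cast hm
  have hden : Real.exp ((φ - δ) / β) * (q * m) ≤ ∑ ℓ ∈ Finset.range m, Real.exp (h ℓ / β) := by
    refine (mul_le_mul_of_nonneg_left hgs (Real.exp_pos _).le).trans ?_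
    rw [Finset.mul_sum]
    refine Finset.sum_le_sum fun ℓ _ => ?_
    by_cases hl : h ℓ < φ - δ
    · exact (mul_nonpos_of_nonneg_of_nonpos (Real.exp_pos _).le (hg0 ℓ hl)).trans
        (Real.exp_pos _).le
    · calc Real.exp ((φ - δ) / β) * g ℓ ≤ Real.exp ((φ - δ) / β) * 1 :=
            mul_le_mul_of_nonneg_left (hg1 ℓ) (Real.exp_pos _).le
        _ ≤ Real.exp (h ℓ / β) := by
            rw [mul_one]
            gcongr
            exact not_lt.1 hl
  have hnum : ∑ ℓ ∈ Finset.range m, Real.exp (h ℓ / β) * a ℓ ≤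
      b * ∑ ℓ ∈ Finset.range m, Real.exp (h ℓ / β) + Real.exp ((φ - 2 * δ) / β) * (C * m) := by
    refine le_trans ?_ (add_le_add le_rfl
      (mul_le_mul_of_nonneg_left hGsum (Real.exp_pos _).le))
    rw [Finset.mul_sum, Finset.mul_sum, ← Finset.sum_add_distrib]
    refine Finset.sum_le_sum fun ℓ _ => ?_
    have he := Real.exp_pos (h ℓ / β)
    have he' := Real.exp_pos ((φ - 2 * δ) / β)
    by_cases hl : φ - 2 * δ ≤ h ℓ
    · have h1 := mul_le_mul_of_nonneg_left (hgood ℓ hl) he.le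
      have h2 := mul_nonneg he'.le (hG ℓ)
      linarith
    · have h1 := mul_le_mul_of_nonneg_left (hbad ℓ) he.le
      have h3 : Real.exp (h ℓ / β) ≤ Real.exp ((φ - 2 * δ) / β) := by
        gcongr
        exact (not_le.1 hl).le
      have h2 := mul_le_mul_of_nonneg_right h3 (hG ℓ)
      linarith
  have hpos : 0 < ∑ ℓ ∈ Finset.range m, Real.exp (h ℓ / β) :=
    lt_of_lt_of_le (by positivity) hden
  rw [div_le_iff₀ hpos, add_mul]
  refine hnum.trans (add_le_add le_rfl ?_)
  -- The gap `δ` between the threshold `φ - δ`, which bounds the denominator below, and `φ - 2δ`,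
  -- beyond which samples are bad, produces the factor `exp (-δ / β)`.
  have hexp : Real.exp ((φ - 2 * δ) / β) = Real.exp ((φ - δ) / β) * Real.exp (-δ / β) := by
    rw [← Real.exp_add]
    congr 1
    ring
  calc Real.exp ((φ - 2 * δ) / β) * (C * m)
      = Real.exp ((φ - δ) / β) * m * (C * Real.exp (-δ / β)) := by rw [hexp]; ring
    _ ≤ Real.exp ((φ - δ) / β) * m * (δ * q) := by gcongr
    _ = δ * (Real.exp ((φ - δ) / β) * (q * m)) := by ring
    _ ≤ _ := by gcongr

end Sampling

/-! ### Derivatives of soft maxima. -/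

section Softmax

variable {E X : Type*} [NormedAddCommGroup E] [NormedSpace ℝ E] {h : E → X → ℝ}
  {h' : E → X → E →L[ℝ] ℝ}

/-- The derivative at `w`, in the direction `u`, of the soft maximum at temperature `β` of the
functions `h · (z ℓ)`, for `ℓ < m`. -/
noncomputable def softmaxSlope (h : E → X → ℝ) (h' : E → X → E →L[ℝ] ℝ) (β : ℝ) (m : ℕ)
    (z : ℕ → X) (w u : E) : ℝ :=
  (∑ ℓ ∈ Finset.range m, Real.exp (h w (z ℓ) / β) * h' w (z ℓ) u) /
    ∑ ℓ ∈ Finset.range m, Real.exp (h w (z ℓ) / β)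

theorem exists_hasFDerivAt_softmax {w : E} (hd : ∀ ζ, HasFDerivAt (fun w => h w ζ) (h' w ζ) w)
    {β : ℝ} (hβ : 0 < β) {m : ℕ} (hm : 0 < m) (z : ℕ → X) :
    ∃ L : E →L[ℝ] ℝ, HasFDerivAt (fun w => β * Real.log ((1 / (m : ℝ)) *
      ∑ ℓ ∈ Finset.range m, Real.exp (h w (z ℓ) / β))) L w ∧
      ∀ u, L u = softmaxSlope h h' β m z w u := by
  have hm' : (0 : ℝ) < m := by exact_mod_cast hm
  have hpos : 0 < ∑ ℓ ∈ Finset.range m, Real.exp (h w (z ℓ) / β) :=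
    Finset.sum_pos (fun _ _ => Real.exp_pos _) (Finset.nonempty_range_iff.2 hm.ne')
  have hexp : ∀ ℓ ∈ Finset.range m, HasFDerivAt (fun w => Real.exp (h w (z ℓ) / β))
      (Real.exp (h w (z ℓ) / β) • (β⁻¹ • h' w (z ℓ))) w := fun ℓ _ => by
    simpa only [div_eq_mul_inv] using ((hd (z ℓ)).mul_const β⁻¹).exp
  have hsum := (HasFDerivAt.fun_sum hexp).const_mul (1 / (m : ℝ))
  refine ⟨_, (hsum.log (mul_pos (one_div_pos.2 hm') hpos).ne').const_mul β, fun u => ?_⟩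
  have hL : (∑ ℓ ∈ Finset.range m, Real.exp (h w (z ℓ) / β) • (β⁻¹ • h' w (z ℓ))) u =
      β⁻¹ * ∑ ℓ ∈ Finset.range m, Real.exp (h w (z ℓ) / β) * h' w (z ℓ) u := by
    rw [_root_.sum_apply, Finset.mul_sum]
    refine Finset.sum_congr rfl fun ℓ _ => ?_
    simp only [_root_.smul_apply, smul_eq_mul]
    ring
  rw [_root_.smul_apply, _root_.smul_apply,
    _root_.smul_apply, hL, softmaxSlope]
  simp only [smul_eq_mul]
  field_simp

theorem differentiableAt_mean_softmax {ι : Type*} [Fintype ι] {H : ι → E → X → ℝ}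
    {H' : ι → E → X → E →L[ℝ] ℝ} {w : E}
    (hd : ∀ i ζ, HasFDerivAt (fun w => H i w ζ) (H' i w ζ) w) {β : ℝ} (hβ : 0 < β) {m : ℕ}
    (hm : 0 < m) (z : ι → ℕ → X) (A : E →L[ℝ] ℝ) (ρ a : ℝ) :
    DifferentiableAt ℝ (fun w => A w * ρ + a * ∑ i, β * Real.log ((1 / (m : ℝ)) *
      ∑ ℓ ∈ Finset.range m, Real.exp (H i w (z i ℓ) / β))) w ∧
      ∀ u, fderiv ℝ (fun w => A w * ρ + a * ∑ i, β * Real.log ((1 / (m : ℝ)) *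
        ∑ ℓ ∈ Finset.range m, Real.exp (H i w (z i ℓ) / β))) w u =
        A u * ρ + a * ∑ i, softmaxSlope (H i) (H' i) β m (z i) w u := by
  choose L hL hLu using fun i => exists_hasFDerivAt_softmax (hd i) hβ hm (z i)
  have hF := (A.hasFDerivAt (x := w).mul_const ρ).fun_add
    ((HasFDerivAt.fun_sum fun i (_ : i ∈ Finset.univ) => hL i).const_mul a)
  refine ⟨hF.differentiableAt, fun u => ?_⟩
  rw [hF.fderiv, _root_.add_apply, _root_.smul_apply, _root_.smul_apply, _root_.sum_apply]
  simp only [hLu, smul_eq_mul, mul_comm ρ]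

end Softmax

/-! ### Suprema of smooth families and their softmax approximation. -/

section Envelope

variable {E X : Type*} [NormedAddCommGroup E] [TopologicalSpace X]
  {h : E → X → ℝ}

/-- A near-maximizer at `w` remains one when both `w` and `ζ` move slightly, since `h` and the
supremum are continuous. A finite subcover of `K` and full support of `ν` then give a uniform `q`.
-/
theorem exists_finite_open_near_maximizers [Nonempty X] [MeasurableSpace X]
    [OpensMeasurableSpace X]
    (hh : Continuous fun q : E × X => h q.1 q.2) {K : Set E} (hK : IsCompact K)
    (hcont : ∀ w ∈ K, ContinuousAt (fun w => ⨆ ζ, h w ζ) w) (ν : Measure X)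
    [IsFiniteMeasure ν] [ν.IsOpenPosMeasure] {δ : ℝ} (hδ : 0 < δ) :
    ∃ (T : Finset E) (O : E → Set X) (q : ℝ), 0 < q ∧
      (∀ t ∈ T, IsOpen (O t) ∧ q < ν.real (O t)) ∧
      ∀ w ∈ K, ∃ t ∈ T, ∀ ζ ∈ O t, (⨆ ζ, h w ζ) - δ ≤ h w ζ := by
  have hloc : ∀ w ∈ K, ∃ U ∈ 𝓝 w, ∃ O : Set X, IsOpen O ∧ O.Nonempty ∧
      ∀ w' ∈ U, ∀ ζ ∈ O, (⨆ ζ, h w' ζ) - δ ≤ h w' ζ := by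
    intro w hw
    obtain ⟨ζ, hζ⟩ := exists_lt_of_lt_ciSup (show (⨆ ζ, h w ζ) - δ < ⨆ ζ, h w ζ by linarith)
    have hca : ContinuousAt (fun q : E × X => (⨆ ζ, h q.1 ζ) - δ) (w, ζ) :=
      (ContinuousAt.comp (f := Prod.fst) (x := (w, ζ)) (hcont w hw)
        continuousAt_fst).sub continuousAt_const
    have hev := hca.eventually_lt hh.continuousAt hζ
    rw [nhds_prod_eq, eventually_prod_iff] at hev
    obtain ⟨p, hp, q, hq, hpq⟩ := hev
    obtain ⟨O, hOq, hO, hζO⟩ := eventually_nhds_iff.1 hq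
    exact ⟨{w | p w}, hp, O, hO, ⟨ζ, hζO⟩, fun w' hw' ζ' hζ' => (hpq hw' (hOq ζ' hζ')).le⟩
  choose! U hU O hO hne hUO using hloc
  obtain ⟨T, hTK, hT⟩ := hK.elim_nhds_subcover U hU
  have hpos : ∀ t ∈ T, 0 < ν.real (O t) := fun t ht =>
    ENNReal.toReal_pos ((hO t (hTK t ht)).measure_ne_zero ν (hne t (hTK t ht)))
      (measure_ne_top ν _)
  have hq : ∃ q > 0, ∀ t ∈ T, q < ν.real (O t) := by
    have : ∀ᶠ q in 𝓝[>] (0 : ℝ), ∀ t ∈ T, q < ν.real (O t) := by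
      rw [Filter.eventually_all_finset]
      exact fun t ht => nhdsWithin_le_nhds (eventually_lt_nhds (hpos t ht))
    obtain ⟨q, hq1, hq2⟩ := (this.and self_mem_nhdsWithin).exists
    exact ⟨q, hq2, hq1⟩
  obtain ⟨q, hq0, hq⟩ := hq
  refine ⟨T, O, q, hq0, fun t ht => ⟨hO t (hTK t ht), hq t ht⟩, fun w hw => ?_⟩
  obtain ⟨t, ht, hwt⟩ := mem_iUnion₂.1 (hT hw)
  exact ⟨t, ht, fun ζ hζ => hUO t (hTK t ht) w hwt ζ hζ⟩

variable [NormedSpace ℝ E] {h' : E → X → E →L[ℝ] ℝ}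

/-- The tube lemma makes the continuity of `h'` at zero displacement uniform over `K ×ˢ Z`, without
a metric on `X`; the mean value inequality concludes. -/
theorem exists_uniform_first_order_expansion
    (hd : ∀ w ζ, HasFDerivAt (fun w => h w ζ) (h' w ζ) w)
    (hc : Continuous fun q : E × X => h' q.1 q.2) {K : Set E} {Z : Set X} (hK : IsCompact K)
    (hZ : IsCompact Z) {η : ℝ} (hη : 0 < η) :
    ∃ r > 0, ∀ w ∈ K, ∀ ζ ∈ Z, ∀ u, ‖u‖ ≤ r →
      h w ζ + h' w ζ u - η * ‖u‖ ≤ h (w + u) ζ := by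
  set O : Set (E × (E × X)) := {q | ‖h' (q.2.1 + q.1) q.2.2 - h' q.2.1 q.2.2‖ < η} with hO
  have hOo : IsOpen O := by
    refine isOpen_lt (Continuous.norm (Continuous.sub ?_ ?_)) continuous_const
    · exact hc.comp (f := fun q : E × (E × X) => (q.2.1 + q.1, q.2.2)) (by fun_prop)
    · exact hc.comp (f := fun q : E × (E × X) => (q.2.1, q.2.2)) (by fun_prop)
  have hsub : ({0} : Set E) ×ˢ (K ×ˢ Z) ⊆ O := by
    rintro ⟨t, θ, ζ⟩ ⟨ht, -⟩
    simp only [mem_singleton_iff] at ht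
    simp [hO, ht, hη]
  obtain ⟨U, V, hU, -, hU0, hV, hUV⟩ :=
    generalized_tube_lemma isCompact_singleton (hK.prod hZ) hOo hsub
  obtain ⟨r, hr, hrU⟩ := Metric.nhds_basis_closedBall.mem_iff.1
    (hU.mem_nhds (hU0 (mem_singleton 0)))
  refine ⟨r, hr, fun w hw ζ hζ u hu => ?_⟩
  have hmv := (convex_closedBall w r).norm_image_sub_le_of_norm_hasFDerivWithin_le' (𝕜 := ℝ)
    (f := fun w => h w ζ) (f' := fun w => h' w ζ) (φ := h' w ζ) (C := η) (x := w) (y := w + u)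
    (fun x _ => (hd x ζ).hasFDerivWithinAt) (fun x hx => ?_)
    (Metric.mem_closedBall_self hr.le) (by simpa [dist_eq_norm] using hu)
  · rw [add_sub_cancel_left, Real.norm_eq_abs] at hmv
    linarith [(abs_le.1 hmv).1]
  · have hm : (x - w, (w, ζ)) ∈ U ×ˢ V :=
      ⟨hrU (by simpa [dist_eq_norm] using hx), hV ⟨hw, hζ⟩⟩
    have := hUV hm
    simp only [hO, mem_ofPred_eq, add_sub_cancel] at this
    exact this.le

/-- Only near-maximizers matter for the supremum, and on the compact set `V ×ˢ Z` the derivative is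
bounded. Convexity of `B` is for the mean value inequality. -/
theorem exists_lipschitzOnWith_iSup [Nonempty X]
    (hd : ∀ w ζ, HasFDerivAt (fun w => h w ζ) (h' w ζ) w)
    (hc : Continuous fun q : E × X => h' q.1 q.2) {V : Set E} {Z : Set X} (hV : IsCompact V)
    (hZ : IsCompact Z) (hbdd : ∀ w ∈ V, BddAbove (range (h w)))
    (hnear : ∀ w ∈ V, ∀ ζ, (⨆ ζ, h w ζ) - 1 ≤ h w ζ → ζ ∈ Z) {B : Set E} (hB : Convex ℝ B)
    (hBV : B ⊆ V) : ∃ L : NNReal, LipschitzOnWith L (fun w => ⨆ ζ, h w ζ) B := by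
  obtain ⟨C, hC⟩ := (hV.prod hZ).exists_bound_of_continuousOn hc.continuousOn
  have key : ∀ w₁ ∈ B, ∀ w₂ ∈ B,
      (⨆ ζ, h w₁ ζ) ≤ (⨆ ζ, h w₂ ζ) + Real.toNNReal C * dist w₁ w₂ := by
    intro w₁ h₁ w₂ h₂
    refine le_of_forall_pos_le_add fun τ hτ => ?_
    -- The cap `1` keeps `ζ` in `Z`, while `τ` makes the error arbitrarily small.
    obtain ⟨ζ, hζ⟩ := exists_lt_of_lt_ciSup
      (show (⨆ ζ, h w₁ ζ) - min τ 1 < ⨆ ζ, h w₁ ζ by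
        have : 0 < min τ 1 := by positivity
        linarith)
    have hζZ : ζ ∈ Z := hnear w₁ (hBV h₁) ζ (by linarith [min_le_right τ 1])
    have hmv := hB.norm_image_sub_le_of_norm_hasFDerivWithin_le (𝕜 := ℝ)
      (f := fun w => h w ζ) (f' := fun w => h' w ζ) (C := Real.toNNReal C)
      (fun x _ => (hd x ζ).hasFDerivWithinAt)
      (fun x hx => (hC (x, ζ) ⟨hBV hx, hζZ⟩).trans (Real.le_coe_toNNReal C)) h₂ h₁
    rw [Real.norm_eq_abs, ← dist_eq_norm] at hmv
    have h3 : h w₂ ζ ≤ ⨆ ζ, h w₂ ζ := le_ciSup (hbdd w₂ (hBV h₂)) ζ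
    linarith [(abs_le.1 hmv).2, min_le_left τ 1]
  refine ⟨Real.toNNReal C, LipschitzOnWith.of_dist_le_mul fun x hx y hy => ?_⟩
  rw [Real.dist_eq, abs_sub_le_iff]
  have h1 := key x hx y hy
  have h2 := key y hy x hx
  rw [dist_comm] at h2
  constructor <;> linarith

/-- Uniformly on `K`, the gradients of the soft maximum over sufficiently many samples are
approximate subgradients of the supremum. -/
theorem exists_temperature_softmaxSlope_minorant [Nonempty X] [MeasurableSpace X]
    [OpensMeasurableSpace X]
    (hh : Continuous fun q : E × X => h q.1 q.2) {K : Set E} (hK : IsCompact K)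
    (hcont : ∀ w ∈ K, ContinuousAt (fun w => ⨆ ζ, h w ζ) w) (ν : Measure X)
    [IsFiniteMeasure ν] [ν.IsOpenPosMeasure] {δ r η : ℝ} (hδ : 0 < δ)
    {G : X → ℝ} (hG0 : ∀ ζ, 0 ≤ G ζ) (hGm : Measurable G) (hGi : Integrable G ν)
    (hbad : ∀ w ∈ K, ∀ ζ u, ‖u‖ ≤ r → (⨆ ζ, h w ζ) + h' w ζ u - 2 * δ - η * ‖u‖ ≤
      (⨆ ζ, h (w + u) ζ) + G ζ)
    (hgood : ∀ w ∈ K, ∀ ζ, (⨆ ζ, h w ζ) - 2 * δ ≤ h w ζ → ∀ u, ‖u‖ ≤ r →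
      (⨆ ζ, h w ζ) + h' w ζ u - 2 * δ - η * ‖u‖ ≤ ⨆ ζ, h (w + u) ζ) :
    ∃ βbar > 0, ∀ β, 0 < β → β ≤ βbar → ∀ (Ω : Type*) [MeasurableSpace Ω] (P : Measure Ω)
      [IsProbabilityMeasure P] (z : ℕ → Ω → X), (∀ ℓ, HasLaw (z ℓ) ν P) → iIndepFun z P →
      ∀ᵐ o ∂P, ∀ᶠ m : ℕ in atTop, ∀ w ∈ K, ∀ u, ‖u‖ ≤ r →
        (⨆ ζ, h w ζ) + softmaxSlope h h' β m (fun ℓ => z ℓ o) w u - η * ‖u‖ - 3 * δ ≤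
          ⨆ ζ, h (w + u) ζ := by
  obtain ⟨T, O, q, hq, hTO, hTK⟩ := exists_finite_open_near_maximizers hh hK hcont ν hδ
  set C : ℝ := ∫ x, G x ∂ν + 1 with hC
  have hC0 : 0 < C := by
    have := integral_nonneg (μ := ν) (f := G) hG0
    linarith
  -- From `exp x ≥ x`, `C * exp (-δ / β) ≤ C * β / δ`, which is at most `δ * q` for this choice.
  refine ⟨δ * (δ * q) / C, by positivity, fun β hβ hβb Ω _ P _ z hlaw hind => ?_⟩
  have hβC : C * Real.exp (-δ / β) ≤ δ * q := by
    rw [le_div_iff₀ hC0] at hβb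
    have h1 : δ / β ≤ Real.exp (δ / β) := (by linarith : δ / β ≤ δ / β + 1).trans
      (Real.add_one_le_exp _)
    rw [neg_div, Real.exp_neg, ← div_eq_mul_inv, div_le_iff₀ (Real.exp_pos _)]
    calc C ≤ δ * q * (δ / β) := by
          rw [mul_div_assoc', le_div_iff₀ hβ]; linarith
      _ ≤ _ := by gcongr
  have hT : ∀ᵐ o ∂P, ∀ t ∈ T, ∀ᶠ m : ℕ in atTop, q * m ≤
      ∑ ℓ ∈ Finset.range m, (O t).indicator (fun _ => (1 : ℝ)) (z ℓ o) := by
    rw [Filter.eventually_all_finset]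
    exact fun t ht => ae_eventually_le_sum_indicator hlaw hind (hTO t ht).1.measurableSet
      (hTO t ht).2
  filter_upwards [hT, ae_eventually_sum_comp_le hlaw hind hGm hGi
    (show ∫ x, G x ∂ν < C by linarith)] with o ho1 ho2
  rw [← Filter.eventually_all_finset] at ho1
  filter_upwards [ho1, ho2, eventually_gt_atTop 0] with m hm1 hm2 hm0 w hw u hu
  obtain ⟨t, ht, htO⟩ := hTK w hw
  -- The direction `u` is fixed first: the average is of the lower bounds that the samples give for
  -- the supremum at `w + u`. Averaging adds one `δ` to their `2δ`.
  have key := softmax_average_le (h := fun ℓ => h w (z ℓ o))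
    (a := fun ℓ => (⨆ ζ, h w ζ) + h' w (z ℓ o) u - 2 * δ - η * ‖u‖)
    (G := fun ℓ => G (z ℓ o)) (φ := ⨆ ζ, h w ζ) (b := ⨆ ζ, h (w + u) ζ) hm0 hβ hδ hq
    (fun ℓ => hG0 _)
    ⟨fun ℓ => (O t).indicator (fun _ => (1 : ℝ)) (z ℓ o),
      fun ℓ => indicator_le_self' (fun _ _ => zero_le_one) _, fun ℓ hl => ?_, hm1 t ht⟩
    hm2 hβC (fun ℓ hl => hgood w hw _ hl u hu) (fun ℓ => hbad w hw _ u hu)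
  · have hpos : 0 < ∑ ℓ ∈ Finset.range m, Real.exp (h w (z ℓ o) / β) :=
      Finset.sum_pos (fun _ _ => Real.exp_pos _) (Finset.nonempty_range_iff.2 hm0.ne')
    have hrw : (∑ ℓ ∈ Finset.range m, Real.exp (h w (z ℓ o) / β) *
        ((⨆ ζ, h w ζ) + h' w (z ℓ o) u - 2 * δ - η * ‖u‖)) /
        ∑ ℓ ∈ Finset.range m, Real.exp (h w (z ℓ o) / β) =
        (⨆ ζ, h w ζ) - 2 * δ - η * ‖u‖ + softmaxSlope h h' β m (fun ℓ => z ℓ o) w u := by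
      rw [softmaxSlope, div_eq_iff hpos.ne', add_mul, div_mul_cancel₀ _ hpos.ne', Finset.mul_sum,
        ← Finset.sum_add_distrib]
      exact Finset.sum_congr rfl fun ℓ _ => by ring
    rw [hrw] at key
    linarith
  · exact (indicator_of_notMem (fun hmem => absurd (htO _ hmem) (not_le.2 hl)) _).le

end Envelope

/-! ### Regularity and compactness for the penalized loss. -/

section Loss

variable {p d J n : ℕ} {f : EuclideanSpace ℝ (Fin p) → Sample d J → ℝ}
  {c : Sample d J → Sample d J → ℝ} {Θ : Set (EuclideanSpace ℝ (Fin p))}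
  {π₀ : Sample d J → Measure (Sample d J)} {mu lam : Sample d J → ℝ}

theorem continuous_of_forall_label {A Y : Type*} [TopologicalSpace A] [TopologicalSpace Y]
    {F : A × Sample d J → Y} (h : ∀ y : Fin J, Continuous fun q : A × EuclideanSpace ℝ (Fin d) =>
      F (q.1, (q.2, y))) : Continuous F := by
  have h1 : Continuous fun q : (A × EuclideanSpace ℝ (Fin d)) × Fin J =>
      F (q.1.1, (q.1.2, q.2)) := continuous_prod_of_discrete_right.2 h
  exact h1.comp (Homeomorph.prodAssoc A (EuclideanSpace ℝ (Fin d)) (Fin J)).symm.continuous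

theorem StandingAssumption.continuous_loss (hA : StandingAssumption Θ f c π₀ mu lam) :
    Continuous fun q : EuclideanSpace ℝ (Fin p) × Sample d J => f q.1 q.2 :=
  continuous_of_forall_label fun y => (hA.differentiable y).continuous

theorem StandingAssumption.hasFDerivAt_loss (hA : StandingAssumption Θ f c π₀ mu lam)
    (ζ : Sample d J) (θ : EuclideanSpace ℝ (Fin p)) :
    HasFDerivAt (fun t => f t ζ) ((fderiv ℝ (fun q : EuclideanSpace ℝ (Fin p) ×
      EuclideanSpace ℝ (Fin d) => f q.1 (q.2, ζ.2)) (θ, ζ.1)).comp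
        (ContinuousLinearMap.inl ℝ _ _)) θ :=
  HasFDerivAt.comp (g := fun q : EuclideanSpace ℝ (Fin p) × EuclideanSpace ℝ (Fin d) =>
    f q.1 (q.2, ζ.2)) (f := fun t => (t, ζ.1)) θ
    (hA.differentiable ζ.2 (θ, ζ.1)).hasFDerivAt (hasFDerivAt_prodMk_left θ ζ.1)

theorem StandingAssumption.continuous_fderiv_loss (hA : StandingAssumption Θ f c π₀ mu lam) :
    Continuous fun q : EuclideanSpace ℝ (Fin p) × Sample d J =>
      fderiv ℝ (fun t => f t q.2) q.1 := by
  refine continuous_of_forall_label fun y => ?_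
  have h : (fun q : EuclideanSpace ℝ (Fin p) × EuclideanSpace ℝ (Fin d) =>
      fderiv ℝ (fun t => f t (q.2, y)) q.1) = fun q => (fderiv ℝ (fun q : EuclideanSpace ℝ (Fin p) ×
      EuclideanSpace ℝ (Fin d) => f q.1 (q.2, y)) q).comp (ContinuousLinearMap.inl ℝ _ _) :=
    funext fun q => (hA.hasFDerivAt_loss (q.2, y) q.1).fderiv
  exact h ▸ (hA.continuous_fderiv y).clm_comp continuous_const

/-- The derivative of the penalized loss in the parameter `(θ, λ)`. -/
noncomputable def penalizedDeriv (f : EuclideanSpace ℝ (Fin p) → Sample d J → ℝ)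
    (c : Sample d J → Sample d J → ℝ) (ξ : Sample d J) (w : Param p) (ζ : Sample d J) :
    Param p →L[ℝ] ℝ :=
  (fderiv ℝ (fun t => f t ζ) w.fst).comp (WithLp.fstL 2 ℝ (EuclideanSpace ℝ (Fin p)) ℝ) -
    c ξ ζ • WithLp.sndL 2 ℝ (EuclideanSpace ℝ (Fin p)) ℝ

theorem penalizedDeriv_apply (ξ : Sample d J) (w : Param p) (ζ : Sample d J) (u : Param p) :
    penalizedDeriv f c ξ w ζ u = fderiv ℝ (fun t => f t ζ) w.fst u.fst - c ξ ζ * u.snd := rfl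

theorem StandingAssumption.hasFDerivAt_penalized (hA : StandingAssumption Θ f c π₀ mu lam)
    (ξ : Sample d J) (w : Param p) (ζ : Sample d J) :
    HasFDerivAt (fun w => penalized f c ξ w ζ) (penalizedDeriv f c ξ w ζ) w := by
  have h1 : HasFDerivAt (fun w : Param p => w.fst)
      (WithLp.fstL 2 ℝ (EuclideanSpace ℝ (Fin p)) ℝ) w :=
    (WithLp.fstL 2 ℝ (EuclideanSpace ℝ (Fin p)) ℝ).hasFDerivAt
  have h2 : HasFDerivAt (fun w : Param p => w.snd)
      (WithLp.sndL 2 ℝ (EuclideanSpace ℝ (Fin p)) ℝ) w :=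
    (WithLp.sndL 2 ℝ (EuclideanSpace ℝ (Fin p)) ℝ).hasFDerivAt
  have h3 := (hA.hasFDerivAt_loss ζ w.fst).differentiableAt.hasFDerivAt.comp w h1
  exact h3.sub (h2.mul_const (c ξ ζ))

theorem continuous_param_fst : Continuous fun w : Param p => w.fst :=
  (WithLp.fstL 2 ℝ (EuclideanSpace ℝ (Fin p)) ℝ).continuous

theorem continuous_param_snd : Continuous fun w : Param p => w.snd :=
  (WithLp.sndL 2 ℝ (EuclideanSpace ℝ (Fin p)) ℝ).continuous

theorem norm_fst_le (w : Param p) : ‖w.fst‖ ≤ ‖w‖ := by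
  have := WithLp.prod_norm_sq_eq_of_L2 w
  nlinarith [sq_nonneg ‖w.snd‖, norm_nonneg w, norm_nonneg w.fst]

theorem abs_snd_le (w : Param p) : |w.snd| ≤ ‖w‖ := by
  have := WithLp.prod_norm_sq_eq_of_L2 w
  rw [← Real.norm_eq_abs]
  nlinarith [sq_nonneg ‖w.fst‖, norm_nonneg w, norm_nonneg w.snd]

theorem StandingAssumption.continuous_cost (hA : StandingAssumption Θ f c π₀ mu lam)
    (ξ : Sample d J) : Continuous (c ξ) :=
  hA.cost_continuous.comp (f := fun ζ => (ξ, ζ)) (by fun_prop)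

theorem StandingAssumption.continuous_penalized (hA : StandingAssumption Θ f c π₀ mu lam)
    (ξ : Sample d J) : Continuous fun q : Param p × Sample d J => penalized f c ξ q.1 q.2 := by
  have h1 := hA.continuous_loss.comp (f := fun q : Param p × Sample d J => (q.1.fst, q.2))
    ((continuous_param_fst.comp continuous_fst).prodMk continuous_snd)
  exact h1.sub ((continuous_param_snd.comp continuous_fst).mul
    ((hA.continuous_cost ξ).comp continuous_snd))

theorem StandingAssumption.continuous_penalizedDeriv (hA : StandingAssumption Θ f c π₀ mu lam)
    (ξ : Sample d J) : Continuous fun q : Param p × Sample d J => penalizedDeriv f c ξ q.1 q.2 := by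
  have h1 := hA.continuous_fderiv_loss.comp
    (f := fun q : Param p × Sample d J => (q.1.fst, q.2))
    ((continuous_param_fst.comp continuous_fst).prodMk continuous_snd)
  exact (h1.clm_comp continuous_const).sub
    (((hA.continuous_cost ξ).comp continuous_snd).smul continuous_const)

theorem isCompact_paramSet (hn : 1 ≤ n) (hΘ : IsCompact Θ) (lamMax : ℝ) (ξ : Fin n → Sample d J) :
    IsCompact (paramSet Θ lam lamMax ξ) := by
  have h1 : IsCompact (⋂ i, Icc (lam (ξ i)) lamMax) :=
    isCompact_Icc.of_isClosed_subset (isClosed_iInter fun i => isClosed_Icc)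
      (iInter_subset _ (⟨0, hn⟩ : Fin n))
  have h2 := (hΘ.prod h1).image
    (WithLp.prodContinuousLinearEquiv 2 ℝ (EuclideanSpace ℝ (Fin p)) ℝ).symm.continuous
  convert h2 using 1
  ext w
  constructor
  · rintro ⟨hw1, hw2⟩
    exact ⟨w.ofLp, ⟨hw1, mem_iInter.2 hw2⟩, rfl⟩
  · rintro ⟨q, ⟨hq1, hq2⟩, rfl⟩
    exact ⟨hq1, mem_iInter.1 hq2⟩

/-- Near a compact set around which the penalized losses are bounded above, their near maximizers
stay in a compact set. -/
theorem StandingAssumption.exists_compact_near_maximizers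
    (hA : StandingAssumption Θ f c π₀ mu lam) {K : Set (Param p)} (hK : IsCompact K)
    (ξ : Fin n → Sample d J)
    (hfin : ∀ w ∈ K, ∃ M : ℝ, ∀ᶠ w' in 𝓝 w, ∀ i ζ, penalized f c (ξ i) w' ζ ≤ M) :
    ∃ R > 0, ∃ (Z : Set (Sample d J)) (C : ℝ), IsCompact Z ∧ 0 ≤ C ∧
      ∀ w ∈ Metric.cthickening R K, ∀ i, BddAbove (range (penalized f c (ξ i) w)) ∧
        |dualFun f c (ξ i) w| ≤ C ∧
        ∀ ζ, dualFun f c (ξ i) w - 1 ≤ penalized f c (ξ i) w ζ → ζ ∈ Z := by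
  have hbd : ∃ M : ℝ, ∀ᶠ w in 𝓝ˢ K, ∀ i ζ, penalized f c (ξ i) w ζ ≤ M := by
    refine hK.induction_on (p := fun S => ∃ M : ℝ, ∀ᶠ w in 𝓝ˢ S, ∀ i ζ,
      penalized f c (ξ i) w ζ ≤ M) ⟨0, by simp⟩ ?_ ?_ ?_
    · rintro S T hST ⟨M, hM⟩
      exact ⟨M, hM.filter_mono (nhdsSet_mono hST)⟩
    · rintro S T ⟨M, hM⟩ ⟨N, hN⟩
      refine ⟨max M N, ?_⟩
      rw [nhdsSet_union, eventually_sup]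
      exact ⟨hM.mono fun w hw i ζ => (hw i ζ).trans (le_max_left _ _),
        hN.mono fun w hw i ζ => (hw i ζ).trans (le_max_right _ _)⟩
    · intro w hw
      obtain ⟨M, hM⟩ := hfin w hw
      refine ⟨{w' | ∀ᶠ w'' in 𝓝 w', ∀ i ζ, penalized f c (ξ i) w'' ζ ≤ M},
        mem_nhdsWithin_of_mem_nhds (eventually_eventually_nhds.2 hM), M, ?_⟩
      exact eventually_nhdsSet_iff_forall.2 fun w' hw' => hw'
  obtain ⟨M, hM⟩ := hbd
  obtain ⟨R, hR, hRM⟩ := (Metric.hasBasis_nhdsSet_cthickening hK).eventually_iff.1 hM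
  have hV : IsCompact (Metric.cthickening (R / 2) K) := hK.cthickening
  -- Lowering `λ` by `R / 2` stays in the region bounded by `M` and adds `R / 2 * c`; the bound
  -- there thus becomes decay at `w`.
  have hdecay : ∀ w ∈ Metric.cthickening (R / 2) K, ∀ i ζ,
      penalized f c (ξ i) w ζ ≤ M - R / 2 * c (ξ i) ζ := by
    intro w hw i ζ
    set e : Param p := WithLp.toLp 2 (0, R / 2)
    have he1 : e.fst = 0 := rfl
    have he2 : e.snd = R / 2 := rfl
    have hen : ‖e‖ ≤ R / 2 := by
      have h1 := WithLp.prod_norm_sq_eq_of_L2 e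
      rw [he1, he2, norm_zero, Real.norm_eq_abs, sq_abs] at h1
      exact le_of_sq_le_sq (by linarith) (by linarith)
    have hmem : w - e ∈ Metric.cthickening R K := by
      have h1 : w - e ∈ Metric.cthickening (R / 2) (Metric.cthickening (R / 2) K) :=
        Metric.mem_cthickening_of_dist_le _ w _ _ hw (by simpa [dist_eq_norm] using hen)
      have h2 := Metric.cthickening_cthickening_subset (half_pos hR).le (half_pos hR).le K h1
      rwa [add_halves] at h2
    have h3 := hRM hmem i ζ
    have h4 : penalized f c (ξ i) (w - e) ζ = penalized f c (ξ i) w ζ + R / 2 * c (ξ i) ζ := by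
      simp only [penalized, he1, he2, WithLp.sub_fst, WithLp.sub_snd, sub_zero]
      ring
    linarith
  have hlow : ∃ M' : ℝ, ∀ w ∈ Metric.cthickening (R / 2) K, ∀ i,
      -M' ≤ penalized f c (ξ i) w (ξ i) := by
    have h1 : ∀ i, ∃ M' : ℝ, ∀ w ∈ Metric.cthickening (R / 2) K,
        ‖penalized f c (ξ i) w (ξ i)‖ ≤ M' := fun i =>
      hV.exists_bound_of_continuousOn ((hA.continuous_penalized (ξ i)).comp
        (f := fun w => (w, ξ i)) (by fun_prop)).continuousOn
    choose M' hM' using h1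
    refine ⟨∑ i, |M' i|, fun w hw i => ?_⟩
    have h2 := hM' i w hw
    rw [Real.norm_eq_abs] at h2
    have h3 := Finset.single_le_sum (f := fun i => |M' i|) (fun j _ => abs_nonneg _)
      (Finset.mem_univ i)
    have := (abs_le.1 h2).1
    have := le_abs_self (M' i)
    linarith
  obtain ⟨M', hM'⟩ := hlow
  -- A value at least `-M' - 1` forces `R / 2 * c ≤ M + M' + 1` by the decay, and sublevel sets of
  -- the cost are compact.
  refine ⟨R / 2, half_pos hR, ⋃ i, {ζ | c (ξ i) ζ ≤ (M + M' + 1) / (R / 2)}, |M| + |M'|,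
    isCompact_iUnion fun i => (hA.cost_coercive (ξ i)).2 _, by positivity, fun w hw i => ?_⟩
  have hle : ∀ ζ, penalized f c (ξ i) w ζ ≤ M := fun ζ => by
    have := mul_nonneg (half_pos hR).le (hA.cost_nonneg (ξ i) ζ)
    linarith [hdecay w hw i ζ]
  have hbdd : BddAbove (range (penalized f c (ξ i) w)) := ⟨M, by rintro _ ⟨ζ, rfl⟩; exact hle ζ⟩
  have hge : -M' ≤ dualFun f c (ξ i) w := (hM' w hw i).trans (le_ciSup hbdd (ξ i))
  refine ⟨hbdd, abs_le.2 ⟨?_, ?_⟩, fun ζ hζ => mem_iUnion.2 ⟨i, ?_⟩⟩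
  · linarith [le_abs_self M', abs_nonneg M]
  · have : Nonempty (Sample d J) := ⟨ξ i⟩
    have : dualFun f c (ξ i) w ≤ M := ciSup_le hle
    linarith [le_abs_self M, abs_nonneg M']
  · change c (ξ i) ζ ≤ _
    rw [le_div_iff₀ (half_pos hR)]
    linarith [hdecay w hw i ζ]

theorem MixedSampling.penalized_translate {κ σ : ℝ} (hS : MixedSampling c π₀ κ σ)
    (ξ ζ : Sample d J) (w : Param p) : penalized f c ξ w (translate ξ ζ) =
      f w.fst (ξ.1 + ζ.1, ζ.2) - w.snd * ‖ζ.1‖ ^ 2 - w.snd * κ * (if ξ.2 ≠ ζ.2 then 1 else 0) := by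
  simp only [penalized, translate, hS.cost_eq, sub_add_cancel_left, norm_neg]
  ring

theorem differentiableAt_sampledObjective (hA : StandingAssumption Θ f c π₀ mu lam) {κ σ : ℝ}
    (hS : MixedSampling c π₀ κ σ) (ξ : Fin n → Sample d J) (ρ : ℝ) {β : ℝ} (hβ : 0 < β) {m : ℕ}
    (hm : 0 < m) (s : ℕ → Sample d J) (w : Param p) :
    DifferentiableAt ℝ (sampledObjective f ξ ρ κ β m s) w ∧ ∀ u,
      fderiv ℝ (sampledObjective f ξ ρ κ β m s) w u = u.snd * ρ + (1 / (n : ℝ)) * ∑ i,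
        softmaxSlope (penalized f c (ξ i)) (penalizedDeriv f c (ξ i)) β m
          (fun ℓ => translate (ξ i) (s ℓ)) w u := by
  have heq : sampledObjective f ξ ρ κ β m s = fun w => w.snd * ρ + (1 / (n : ℝ)) *
      ∑ i, β * Real.log ((1 / (m : ℝ)) * ∑ ℓ ∈ Finset.range m,
        Real.exp (penalized f c (ξ i) w (translate (ξ i) (s ℓ)) / β)) := by
    funext w
    simp only [sampledObjective, hS.penalized_translate, ← Finset.mul_sum]
    ring
  rw [heq]
  exact differentiableAt_mean_softmax (fun i ζ => hA.hasFDerivAt_penalized (ξ i) w ζ) hβ hm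
    (fun i ℓ => translate (ξ i) (s ℓ)) (WithLp.sndL 2 ℝ (EuclideanSpace ℝ (Fin p)) ℝ) ρ
    (1 / (n : ℝ))

end Loss

/-! ### Integrable envelopes and assembly of the estimates. -/

section Consistency

variable {p d J n : ℕ} {f : EuclideanSpace ℝ (Fin p) → Sample d J → ℝ}
  {c : Sample d J → Sample d J → ℝ} {Θ : Set (EuclideanSpace ℝ (Fin p))}
  {π₀ : Sample d J → Measure (Sample d J)} {mu lam : Sample d J → ℝ}

/-- Dominate `g` by `1 + g ^ (1 + a)`. -/
theorem integrable_of_integrable_rpow {X : Type*} [MeasurableSpace X] {ν : Measure X}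
    [IsFiniteMeasure ν] {g : X → ℝ} {a : ℝ} (ha : 0 < a) (hg : Measurable g) (hg0 : ∀ x, 0 ≤ g x)
    (hi : Integrable (fun x => g x ^ (1 + a)) ν) : Integrable g ν := by
  refine ((integrable_const (1 : ℝ)).add hi).mono' hg.aestronglyMeasurable (ae_of_all _ fun x => ?_)
  rw [Real.norm_of_nonneg (hg0 x)]
  have h2 := Real.rpow_nonneg (hg0 x) (1 + a)
  simp only [Pi.add_apply]
  rcases le_total (g x) 1 with h | h
  · linarith
  · have := Real.self_le_rpow_of_one_le h (by linarith : 1 ≤ 1 + a)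
    linarith

theorem exists_lipschitzOnWith_objective (ξ : Fin n → Sample d J) (ρ : ℝ) {B : Set (Param p)}
    (h : ∀ i, ∃ L : NNReal, LipschitzOnWith L (dualFun f c (ξ i)) B) :
    ∃ L : NNReal, LipschitzOnWith L (objective f c ξ ρ) B := by
  choose L hL using h
  refine ⟨‖ρ‖₊ + ‖1 / (n : ℝ)‖₊ * ∑ i, L i, LipschitzOnWith.of_dist_le_mul fun x hx y hy => ?_⟩
  have h1 : objective f c ξ ρ x - objective f c ξ ρ y = ρ * (x - y).snd +
      1 / (n : ℝ) * ∑ i, (dualFun f c (ξ i) x - dualFun f c (ξ i) y) := by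
    rw [objective, objective, Finset.sum_sub_distrib, WithLp.sub_snd]
    ring
  have h2 : ‖∑ i, (dualFun f c (ξ i) x - dualFun f c (ξ i) y)‖ ≤ (∑ i, (L i : ℝ)) * dist x y := by
    rw [Finset.sum_mul]
    refine norm_sum_le_of_le _ fun i _ => ?_
    rw [← dist_eq_norm]
    exact (hL i).dist_le_mul x hx y hy
  rw [dist_eq_norm, h1]
  refine (norm_add_le _ _).trans ?_
  rw [norm_mul, norm_mul, NNReal.coe_add, NNReal.coe_mul, NNReal.coe_sum, coe_nnnorm, coe_nnnorm,
    add_mul, mul_assoc ‖1 / (n : ℝ)‖]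
  gcongr
  rw [dist_eq_norm]
  exact abs_snd_le _

theorem iIndepFun_translate {Ω : Type*} [MeasurableSpace Ω] {P : Measure Ω}
    {s : ℕ → Ω → Sample d J} (hs : iIndepFun s P) (ξ : Sample d J) :
    iIndepFun (fun ℓ o => translate ξ (s ℓ o)) P :=
  hs.comp (fun _ => translate ξ) fun _ => measurable_translate ξ

theorem hasLaw_translate {Ω : Type*} [MeasurableSpace Ω] {P : Measure Ω} {X : Ω → Sample d J}
    {σ : ℝ} (hX : HasLaw X (gaussianUnif J 0 σ) P) (ξ : Sample d J) :
    HasLaw (fun o => translate ξ (X o)) (gaussianUnif J ξ.1 σ) P :=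
  HasLaw.fun_comp ⟨(measurable_translate ξ).aemeasurable, map_translate_gaussianUnif ξ σ⟩ hX

/-- Supplies the envelope, uniform in `w` and `u`, that controls the samples far from maximal. -/
theorem abs_penalizedDeriv_le {ψ : Sample d J → ℝ} (hc : ∀ ξ ζ, 0 ≤ c ξ ζ) {w : Param p}
    {ζ : Sample d J} (hψ : ‖gradient (fun t => f t ζ) w.fst‖ ≤ ψ ζ) (ξ : Sample d J)
    {u : Param p} (hu : ‖u‖ ≤ 1) : |penalizedDeriv f c ξ w ζ u| ≤ ψ ζ + c ξ ζ := by
  rw [gradient, LinearIsometryEquiv.norm_map] at hψ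
  have h1 : ‖fderiv ℝ (fun t => f t ζ) w.fst u.fst‖ ≤ ψ ζ := by
    refine (ContinuousLinearMap.le_opNorm _ _).trans ?_
    calc _ ≤ ψ ζ * 1 := mul_le_mul hψ ((norm_fst_le u).trans hu) (norm_nonneg _)
          ((norm_nonneg _).trans hψ)
      _ = ψ ζ := mul_one _
  have h2 : |c ξ ζ * u.snd| ≤ c ξ ζ := by
    rw [abs_mul, abs_of_nonneg (hc ξ ζ)]
    exact mul_le_of_le_one_right (hc ξ ζ) ((abs_snd_le u).trans hu)
  rw [penalizedDeriv_apply]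
  exact (abs_sub _ _).trans (add_le_add h1 h2)

end Consistency

end WDRO

open WDRO in
theorem mainTheorem5 {p d J n : ℕ} (hJ : 1 ≤ J) (hn : 1 ≤ n)
    (Θ : Set (EuclideanSpace ℝ (Fin p))) (hΘcompact : IsCompact Θ) (hΘconvex : Convex ℝ Θ)
    (f : EuclideanSpace ℝ (Fin p) → WDRO.Sample d J → ℝ)
    (c : WDRO.Sample d J → WDRO.Sample d J → ℝ)
    (π₀ : WDRO.Sample d J → Measure (WDRO.Sample d J))
    (mu lam : WDRO.Sample d J → ℝ) (κ σ ρ lamMax : ℝ)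
    (ξ : Fin n → WDRO.Sample d J)
    (hρ : 0 < ρ) (hlamMax : 0 < lamMax)
    (hA : WDRO.StandingAssumption Θ f c π₀ mu lam)
    (hS : WDRO.MixedSampling c π₀ κ σ)
    -- `Λ` is contained in the positive half-line
    (hΛ : ∀ w ∈ WDRO.paramSet Θ lam lamMax ξ, 0 < w.snd)
    -- the objective is finite and bounded near every point of `Θ × Λ`
    (hfin : ∀ w ∈ WDRO.paramSet Θ lam lamMax ξ, ∃ M : ℝ, ∀ᶠ w' in 𝓝 w,
      ∀ i ζ, WDRO.penalized f c (ξ i) w' ζ ≤ M)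
    (ε : ℝ) (hε : 0 < ε) :
    ∃ βbar : ℝ, 0 < βbar ∧ ∀ β : ℝ, 0 < β → β ≤ βbar →
      ∀ (Ω : Type*) [MeasurableSpace Ω] (P : Measure Ω) [IsProbabilityMeasure P]
        (s : ℕ → Ω → WDRO.Sample d J),
        (∀ ℓ, HasLaw (s ℓ) (WDRO.gaussianUnif J 0 σ) P) → iIndepFun s P →
        ∀ᵐ o ∂P, ∃ mbar : ℕ, ∀ m : ℕ, mbar ≤ m → ∀ w ∈ WDRO.paramSet Θ lam lamMax ξ,
          DifferentiableAt ℝ (WDRO.sampledObjective f ξ ρ κ β m (fun ℓ => s ℓ o)) w ∧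
          gradient (WDRO.sampledObjective f ξ ρ κ β m (fun ℓ => s ℓ o)) w ∈
            WDRO.enlargement
              (WDRO.clarkeSubdifferential (WDRO.finiteDomain f c ξ) (WDRO.objective f c ξ ρ))
              ε w := by
  -- A point of `Θ` is needed below to see that `ψ ≥ 0`.
  rcases (paramSet Θ lam lamMax ξ).eq_empty_or_nonempty with hempty | hne
  · refine ⟨1, one_pos, fun β _ _ Ω _ P _ s _ _ => ae_of_all _ fun o => ⟨0, fun m _ w hw => ?_⟩⟩
    rw [hempty] at hw
    exact hw.elim
  have hn' : (0 : ℝ) < n := by exact_mod_cast hn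
  have hK := isCompact_paramSet (lam := lam) hn hΘcompact lamMax ξ
  set K := paramSet Θ lam lamMax ξ with hKdef
  have hX : Nonempty (Sample d J) := ⟨ξ ⟨0, hn⟩⟩
  obtain ⟨R, hR, Z, C, hZ, hC, hgeo⟩ := hA.exists_compact_near_maximizers hK ξ hfin
  have hVc : IsCompact (Metric.cthickening R K) := hK.cthickening
  have hlip : ∀ B : Set (Param p), Convex ℝ B → B ⊆ Metric.cthickening R K →
      ∀ i, ∃ L : NNReal, LipschitzOnWith L (dualFun f c (ξ i)) B := fun B hB hBV i =>
    exists_lipschitzOnWith_iSup (hA.hasFDerivAt_penalized (ξ i)) (hA.continuous_penalizedDeriv _)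
      hVc hZ (fun w hw => (hgeo w hw i).1) (fun w hw => (hgeo w hw i).2.2) hB hBV
  have hball : ∀ w ∈ K, ∀ w', ‖w' - w‖ ≤ R / 2 →
      Metric.ball w' (R / 2) ⊆ Metric.cthickening R K := by
    intro w hw w' hw' x hx
    refine Metric.mem_cthickening_of_dist_le _ w _ _ hw ?_
    rw [Metric.mem_ball] at hx
    rw [← dist_eq_norm] at hw'
    linarith [dist_triangle x w' w]
  have hcont : ∀ i, ∀ w ∈ K, ContinuousAt (fun w => ⨆ ζ, penalized f c (ξ i) w ζ) w := by
    intro i w hw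
    obtain ⟨L, hL⟩ := hlip _ (convex_ball w (R / 2))
      (hball w hw w (by simpa using (half_pos hR).le)) i
    exact hL.continuousOn.continuousAt (Metric.ball_mem_nhds w (half_pos hR))
  set η : ℝ := ε / 4 with hη
  have hη0 : 0 < η := by positivity
  choose r₀ hr₀ hexp using fun i => exists_uniform_first_order_expansion
    (hA.hasFDerivAt_penalized (ξ i)) (hA.continuous_penalizedDeriv (ξ i)) hK hZ hη0
  obtain ⟨r, hr, hrR, hr1, hrε, hrr₀⟩ : ∃ r > 0, r ≤ R / 2 ∧ r ≤ 1 ∧ r ≤ ε ∧ ∀ i, r ≤ r₀ i := by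
    have hev : ∀ᶠ r in 𝓝[>] (0 : ℝ), r ≤ R / 2 ∧ r ≤ 1 ∧ r ≤ ε ∧ ∀ i, r ≤ r₀ i :=
      nhdsWithin_le_nhds ((eventually_le_nhds (half_pos hR)).and
        ((eventually_le_nhds one_pos).and ((eventually_le_nhds hε).and
          (eventually_all.2 fun i => eventually_le_nhds (hr₀ i)))))
    obtain ⟨r, h1, h2⟩ := (hev.and self_mem_nhdsWithin).exists
    exact ⟨r, h2, h1⟩
  -- `2δ ≤ 1` keeps the good samples in `Z`; `3δ < η r` is what the variational step requires.
  set δ : ℝ := min (1 / 2) (η * r / 6) with hδ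
  have hδ0 : 0 < δ := by positivity
  have hδ1 : 2 * δ ≤ 1 := by linarith [min_le_left (1 / 2) (η * r / 6)]
  have hδ3 : 3 * δ < η * r := by
    have := mul_pos hη0 hr
    linarith [min_le_right (1 / 2) (η * r / 6)]
  have hmemV : ∀ w ∈ K, ∀ u : Param p, ‖u‖ ≤ r → w + u ∈ Metric.cthickening R K :=
    fun w hw u hu => Metric.mem_cthickening_of_dist_le _ w _ _ hw (by
      rw [dist_eq_norm, add_sub_cancel_left]
      linarith)
  have hKV : ∀ w ∈ K, w ∈ Metric.cthickening R K := fun w hw =>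
    Metric.self_subset_cthickening K hw
  obtain ⟨a, ψ, ha, hψc, hci, hψ, hψi⟩ := hA.ref_moments
  obtain ⟨w₀, hw₀⟩ := hne
  have hψ0 : ∀ ζ, 0 ≤ ψ ζ := fun ζ => (norm_nonneg _).trans (hψ ζ w₀.fst hw₀.1).le
  have hprob : ∀ i, IsProbabilityMeasure (gaussianUnif J (ξ i).1 σ) := fun i =>
    hS.ref_eq (ξ i) ▸ hA.ref_prob (ξ i)
  have hsub : ∀ i, ∀ w ∈ K, ∀ ζ, ∀ u, ‖u‖ ≤ r → dualFun f c (ξ i) w - 2 * δ ≤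
      penalized f c (ξ i) w ζ → dualFun f c (ξ i) w + penalizedDeriv f c (ξ i) w ζ u - 2 * δ -
        η * ‖u‖ ≤ dualFun f c (ξ i) (w + u) := by
    intro i w hw ζ u hu hζ
    have h1 := hexp i w hw ζ ((hgeo w (hKV w hw) i).2.2 ζ (by linarith)) u (hu.trans (hrr₀ i))
    have h2 : penalized f c (ξ i) (w + u) ζ ≤ dualFun f c (ξ i) (w + u) :=
      le_ciSup (hgeo _ (hmemV w hw u hu) i).1 ζ
    linarith
  have hbeta := fun i => by
    have := isOpenPosMeasure_gaussianUnif hJ (ξ i).1 hS.sigma_pos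
    have hcm := (hA.continuous_cost (ξ i)).measurable
    have hψm := hψc.1.measurable
    -- In `G`, `2 * C` covers the change of the supremum between `w` and `w + u`, and `ψ + c` covers
    -- the slope.
    refine exists_temperature_softmaxSlope_minorant (h' := penalizedDeriv f c (ξ i)) (r := r)
      (η := η) (G := fun ζ => 2 * C + (ψ ζ + c (ξ i) ζ)) (hA.continuous_penalized (ξ i)) hK
      (hcont i)
      (gaussianUnif J (ξ i).1 σ) hδ0
      (fun ζ => by linarith [hψ0 ζ, hA.cost_nonneg (ξ i) ζ]) (by fun_prop) ?_ ?_ ?_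
    · refine (integrable_const _).add (Integrable.add ?_ ?_)
      · exact integrable_of_integrable_rpow ha hψm hψ0 (hS.ref_eq (ξ i) ▸ hψi (ξ i))
      · exact integrable_of_integrable_rpow ha hcm (hA.cost_nonneg _)
          (hS.ref_eq (ξ i) ▸ hci (ξ i))
    · intro w hw ζ u hu
      have h1 := (abs_le.1 (hgeo w (hKV w hw) i).2.1).2
      have h2 := (abs_le.1 (hgeo _ (hmemV w hw u hu) i).2.1).1
      have h3 := (abs_le.1 (abs_penalizedDeriv_le hA.cost_nonneg (hψ ζ w.fst hw.1).le (ξ i)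
        (hu.trans hr1))).2
      have h4 := mul_nonneg hη0.le (norm_nonneg u)
      simp only [dualFun] at h1 h2
      linarith
    · exact fun w hw ζ hζ u hu => hsub i w hw ζ u hu hζ
  choose βb hβb hmin using hbeta
  obtain ⟨βbar, hβbar, hβle⟩ : ∃ βbar > 0, ∀ i, βbar ≤ βb i := by
    have hev : ∀ᶠ b in 𝓝[>] (0 : ℝ), ∀ i, b ≤ βb i :=
      nhdsWithin_le_nhds (eventually_all.2 fun i => eventually_le_nhds (hβb i))
    obtain ⟨b, h1, h2⟩ := (hev.and self_mem_nhdsWithin).exists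
    exact ⟨b, h2, h1⟩
  refine ⟨βbar, hβbar, fun β hβ hβ' Ω _ P _ s hs hsi => ?_⟩
  have hall := ae_all_iff.2 fun i => hmin i β hβ (hβ'.trans (hβle i)) Ω P
    (fun ℓ o => translate (ξ i) (s ℓ o)) (fun ℓ => hasLaw_translate (hs ℓ) (ξ i))
    (iIndepFun_translate hsi (ξ i))
  filter_upwards [hall] with o ho
  obtain ⟨mbar, hmbar⟩ := eventually_atTop.1 (eventually_all.2 ho)
  -- `m = 0` is excluded because the softmax derivative formula needs a nonempty sum.
  refine ⟨max mbar 1, fun m hm w hw => ?_⟩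
  obtain ⟨hdiff, hder⟩ := differentiableAt_sampledObjective hA hS ξ ρ hβ
    (lt_of_lt_of_le one_pos ((le_max_right _ _).trans hm)) (fun ℓ => s ℓ o) w
  refine ⟨hdiff, mem_enlargement_of_approx_minorant hr hη0 hδ3 hrε (by linarith) ?_ ?_⟩
  · intro w' hw'
    have hB := hball w hw w' (hw'.trans hrR)
    obtain ⟨L, hL⟩ := exists_lipschitzOnWith_objective ξ ρ (hlip _ (convex_ball w' (R / 2)) hB)
    exact ⟨L, R / 2, half_pos hR, fun x hx i => (hgeo x (hB hx) i).1, hL⟩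
  · intro u hu
    rw [inner_gradient_left, hder]
    -- Averaging over `i` keeps the errors `η ‖u‖` and `3δ`; the term `λ ρ` is linear and adds none.
    have hsum : ∑ i, (dualFun f c (ξ i) w + softmaxSlope (penalized f c (ξ i))
        (penalizedDeriv f c (ξ i)) β m (fun ℓ => translate (ξ i) (s ℓ o)) w u - η * ‖u‖ - 3 * δ) ≤
        ∑ i, dualFun f c (ξ i) (w + u) :=
      Finset.sum_le_sum fun i _ => hmbar m ((le_max_left _ _).trans hm) i w hw u hu
    simp only [Finset.sum_sub_distrib, Finset.sum_add_distrib, Finset.sum_const, Finset.card_univ,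
      Fintype.card_fin, nsmul_eq_mul] at hsum
    have hsum' := mul_le_mul_of_nonneg_left hsum (one_div_pos.2 hn').le
    have hone : 1 / (n : ℝ) * n = 1 := one_div_mul_cancel hn'.ne'
    simp only [mul_sub, mul_add, ← mul_assoc, hone, one_mul] at hsum'
    rw [objective, objective, WithLp.add_snd]
    linarith
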